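/- **Setting.** Let $(M^{2n+1},J,\theta)$, $n\ge 1$, be a strictly pseudoconvex pseudohermitian manifold: $\theta$ is a smooth contact form, $J$ is a formally integrable complex structure on $H=\ker\theta$, and $d\theta(X,JX)>0$ for $0\ne X\in H$. Let $T$ be the Reeb field ($\theta(T)=1$, $T\lrcorner d\theta=0$), let $\{\theta,\theta^\alpha,\theta^{\bar\alpha}\}$ be a local admissible coframe with dual frame $\{T,Z_\alpha,Z_{\bar\alpha}\}$, where $Z_\alpha\in T^{1,0}$, and write $d\theta=ih_{\alpha\bar\beta}\,\theta^\alpha\wedge\theta^{\bar\beta}$. The Tanaka–Webster connection forms $\omega_\alpha{}^\beta$ and the torsion $A_{\alpha\beta}$ are determined by $$d\theta^\beta=\theta^\alpha\wedge\omega_\alpha{}^\beta+\theta\wedge\tau^\beta,\quad \tau_\alpha=A_{\alpha\beta}\theta^\beta,\quad \omega_{\alpha\bar\beta}+\omega_{\bar\beta\alpha}=dh_{\alpha\bar\beta},\quad A_{\alpha\beta}=A_{\beta\alpha},$$ indices being raised and lowered with $h_{\alpha\bar\beta}$. The Ricci tensor $R_{\alpha\bar\beta}$ is the coefficient of $\theta^\alpha\wedge\theta^{\bar\beta}$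 in $d\omega_\gamma{}^\gamma$, and $R=R_\alpha{}^\alpha$. Put $\Delta_b=-(\nabla^\alpha\nabla_\alpha+\nabla_\alpha\nabla^\alpha)$, $\nabla_0=\nabla_T$, $|A|^2=A_{\alpha\beta}A^{\alpha\beta}$, $P_{\alpha\bar\beta}=\frac1{n+2}\big(R_{\alpha\bar\beta}-\frac{1}{2(n+1)}Rh_{\alpha\bar\beta}\big)$, $P=\frac{R}{2(n+1)}$ and $\mathring P_{\alpha\bar\beta}=P_{\alpha\bar\beta}-\frac Pn h_{\alpha\bar\beta}$. The CR Paneitz operator is $$\begin{aligned}P_4f={}&\Delta_b^2f+\nabla_0^2f-4\,\mathrm{Im}\,\nabla^\alpha(A_{\alpha\beta}\nabla^\beta f)+4\,\mathrm{Re}\,\nabla_{\bar\beta}(\mathring P^{\alpha\bar\beta}\nabla_\alpha f)\\&-\tfrac{4(n^2-1)}n\,\mathrm{Re}\,\nabla^\beta(P\nabla_\beta f)+\tfrac{n-1}2Q_4f,\end{aligned}$$ $$Q_4=\tfrac{2(n+1)^2}{n(n+2)}\Delta_bP-\tfrac4{n(n+2)}\mathrm{Im}\,\nabla^\alpha\nabla^\beta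 A_{\alpha\beta}-\tfrac{2(n-1)}n|A|^2-\tfrac{2(n+1)}n|\mathring P|^2+\tfrac{2(n-1)(n+1)^2}{n^2}P^2.$$ The manifold is *pseudo-Einstein* if $R_{\alpha\bar\beta}-\frac1nRh_{\alpha\bar\beta}=0$ (when $n\ge2$), respectively $\nabla_\alpha R-i\nabla^\beta A_{\alpha\beta}=0$ (when $n=1$). On a pseudo-Einstein manifold the *$Q'$-curvature* is $Q_4'=\frac{4}{(n-1)^2}P_4(1)$ when $n\ge2$. When $n=1$ it is the formal limit of this expression as $n\to1$, that is: $Q_4'$ is the value at $n=1$ of a linear combination of $\Delta_bR$, $\mathrm{Im}\,\nabla^\alpha\nabla^\beta A_{\alpha\beta}$, $|A|^2$, $|\mathring P|^2$, $R^2$ whose coefficients are rational functions of $n$ without poles at the integers $n\ge1$, and which equals $\frac4{(n-1)^2}P_4(1)$ on every pseudo-Einstein manifold of every dimension $2n+1$ with $n\ge2$. **Lemma.** Let $(M^{2n+1},J,\theta)$ be a pseudo-Einstein manifold, $n\ge1$. Then the $Q'$-curvature is given by $$Q_4'=\frac2{n^2}\Delta_bR-\frac4n|A|^2+\frac1{n^2}R^2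 .$$ In particular, when $n=1$ it is given by $Q_4'=2\Delta_bR-4|A|^2+R^2$. -/

import Mathlib

open scoped Manifold ContDiff

noncomputable section

namespace CRGeometry

universe u

/-- The model space `ℝ^{2n+1}` of a manifold of CR dimension `n`. -/
abbrev Model (n : ℕ) : Type := EuclideanSpace ℝ (Fin (2 * n + 1))

/-- Complex vector fields `Z = re + i im` (sections of `ℂ ⊗ TM`, without regularity). -/
structure CField (n : ℕ) (M : Type u) [TopologicalSpace M] [ChartedSpace (Model n) M] where
  /-- the real part -/
  re : (p : M) → TangentSpace (𝓡 (2 * n + 1)) p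
  /-- the imaginary part -/
  im : (p : M) → TangentSpace (𝓡 (2 * n + 1)) p

/-- Complex-valued differential `1`-forms (without regularity). -/
abbrev CForm (n : ℕ) (M : Type u) [TopologicalSpace M] [ChartedSpace (Model n) M] : Type u :=
  (p : M) → TangentSpace (𝓡 (2 * n + 1)) p →L[ℝ] ℂ

section Basic

variable {n : ℕ} {M : Type u} [TopologicalSpace M] [ChartedSpace (Model n) M]

namespace CField

/-- A real vector field, as a complex one. -/
def ofReal (X : (p : M) → TangentSpace (𝓡 (2 * n + 1)) p) : CField n M := ⟨X, fun _ => 0⟩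

/-- The conjugate vector field. -/
def conj (Z : CField n M) : CField n M := ⟨Z.re, fun p => -Z.im p⟩

/-- The complex bilinear extension of the Lie bracket of vector fields. -/
def bracket (Z W : CField n M) : CField n M :=
  ⟨fun p => VectorField.mlieBracket (𝓡 (2 * n + 1)) Z.re W.re p
      - VectorField.mlieBracket (𝓡 (2 * n + 1)) Z.im W.im p,
   fun p => VectorField.mlieBracket (𝓡 (2 * n + 1)) Z.re W.im p
      + VectorField.mlieBracket (𝓡 (2 * n + 1)) Z.im W.re p⟩

/-- The derivative `Z f` of a complex-valued function along a complex vector field. -/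
def D (Z : CField n M) (f : M → ℂ) (p : M) : ℂ :=
  let df : TangentSpace (𝓡 (2 * n + 1)) p →L[ℝ] ℂ := mfderiv (𝓡 (2 * n + 1)) 𝓘(ℝ, ℂ) f p
  df (Z.re p) + Complex.I * df (Z.im p)

end CField

namespace CForm

/-- The value `φ(Z)` of a form on a complex vector field (complex linear in `Z`). -/
def ap (φ : CForm n M) (Z : CField n M) (p : M) : ℂ :=
  φ p (Z.re p) + Complex.I * φ p (Z.im p)

/-- The conjugate form. -/
def conj (φ : CForm n M) : CForm n M :=
  fun p => (Complex.conjCLE : ℂ →L[ℝ] ℂ).comp (φ p)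

/-- The exterior derivative, `dφ(Z, W) = Z(φ(W)) - W(φ(Z)) - φ([Z, W])`. -/
def extd (φ : CForm n M) (Z W : CField n M) (p : M) : ℂ :=
  Z.D (φ.ap W) p - W.D (φ.ap Z) p - φ.ap (Z.bracket W) p

/-- The wedge product of two `1`-forms, `(φ ∧ ψ)(Z, W) = φ(Z) ψ(W) - φ(W) ψ(Z)`. -/
def wedge (φ ψ : CForm n M) (Z W : CField n M) (p : M) : ℂ :=
  φ.ap Z p * ψ.ap W p - φ.ap W p * ψ.ap Z p

end CForm

/-- The complexification of a real `1`-form. -/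
def complexify (θ : (p : M) → TangentSpace (𝓡 (2 * n + 1)) p →L[ℝ] ℝ) : CForm n M :=
  fun p => Complex.ofRealCLM.comp (θ p)

/-- `Z` is a section of `T^{1,0}` over `U`, where `T^{1,0} ⊆ ℂ ⊗ H` is the `+i`-eigenspace of `J`
on `H = ker θ`: one has `Z = X - i J X` with `X` in `H`. -/
def IsOneZeroOn (θ : (p : M) → TangentSpace (𝓡 (2 * n + 1)) p →L[ℝ] ℝ)
    (J : (p : M) → TangentSpace (𝓡 (2 * n + 1)) p →L[ℝ] TangentSpace (𝓡 (2 * n + 1)) p)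
    (Z : CField n M) (U : Set M) : Prop :=
  ∀ p ∈ U, θ p (Z.re p) = 0 ∧ Z.im p = -J p (Z.re p)

end Basic

section Structures

variable {n : ℕ} {M : Type u} [TopologicalSpace M] [ChartedSpace (Model n) M]
  [IsManifold (𝓡 (2 * n + 1)) ∞ M]

/-- `X` is smooth on `U`, as a section of the tangent bundle. -/
def SmoothFieldOn (X : (p : M) → TangentSpace (𝓡 (2 * n + 1)) p) (U : Set M) : Prop :=
  ContMDiffOn (𝓡 (2 * n + 1)) (𝓡 (2 * n + 1)).tangent ∞
    (fun p => (⟨p, X p⟩ : TangentBundle (𝓡 (2 * n + 1)) M)) U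

/-- A complex vector field is smooth on `U`. -/
def CField.SmoothOn (Z : CField n M) (U : Set M) : Prop :=
  SmoothFieldOn Z.re U ∧ SmoothFieldOn Z.im U

variable (n M) in
/-- A strictly pseudoconvex pseudohermitian structure `(J, θ)` on a manifold `M` of dimension
`2n+1`: a smooth real `1`-form `θ` and a smooth, formally integrable complex structure `J` on
`H = ker θ`, such that `dθ(X, J X) > 0` for `X ≠ 0` in `H`.  Only the restriction of `J p` to
`ker (θ p)` is meaningful, and only that restriction is ever used. -/
structure Pseudohermitian where
  /-- the contact form -/
  θ : (p : M) → TangentSpace (𝓡 (2 * n + 1)) p →L[ℝ] ℝ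
  /-- the complex structure on `ker θ` -/
  J : (p : M) → TangentSpace (𝓡 (2 * n + 1)) p →L[ℝ] TangentSpace (𝓡 (2 * n + 1)) p
  θ_ne_zero : ∀ p, θ p ≠ 0
  θ_smooth : ∀ U : Set M, IsOpen U → ∀ X, SmoothFieldOn X U →
    ContMDiffOn (𝓡 (2 * n + 1)) 𝓘(ℝ, ℝ) ∞ (fun p => θ p (X p)) U
  J_mem : ∀ p v, θ p v = 0 → θ p (J p v) = 0
  J_sq : ∀ p v, θ p v = 0 → J p (J p v) = -v
  J_smooth : ∀ U : Set M, IsOpen U → ∀ X, SmoothFieldOn X U → (∀ p ∈ U, θ p (X p) = 0) →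
    SmoothFieldOn (fun p => J p (X p)) U
  /-- formal integrability: `[T^{1,0}, T^{1,0}] ⊆ T^{1,0}` -/
  integrable : ∀ U : Set M, IsOpen U → ∀ Z W : CField n M, Z.SmoothOn U → W.SmoothOn U →
    IsOneZeroOn θ J Z U → IsOneZeroOn θ J W U → IsOneZeroOn θ J (Z.bracket W) U
  /-- strict pseudoconvexity: `dθ(X, J X)` is positive for `X ≠ 0` in `H` -/
  pseudoconvex : ∀ U : Set M, IsOpen U → ∀ X, SmoothFieldOn X U → (∀ p ∈ U, θ p (X p) = 0) →
    ∀ p ∈ U, X p ≠ 0 →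
      0 < ((complexify θ).extd (CField.ofReal X) (CField.ofReal fun q => J q (X q)) p).re

/-- An admissible coframe `{θ, θ^α, θ^{ᾱ}}` over an open set `U`, with the dual frame
`{T, Z_α, Z_{ᾱ}}`; here `T` is the Reeb vector field, `θ(T) = 1` and `dθ(T, ·) = 0`. -/
structure AdmissibleFrame (S : Pseudohermitian n M) (U : Set M) where
  isOpen : IsOpen U
  /-- the Reeb vector field `T` -/
  reeb : (p : M) → TangentSpace (𝓡 (2 * n + 1)) p
  /-- the frame `Z_α` of `T^{1,0}` -/
  Z : Fin n → CField n M
  /-- the `(1,0)`-forms `θ^α` -/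
  ϑ : Fin n → CForm n M
  reeb_smooth : SmoothFieldOn reeb U
  Z_smooth : ∀ α, (Z α).SmoothOn U
  ϑ_smooth : ∀ α, ∀ V : Set M, IsOpen V → V ⊆ U → ∀ X, SmoothFieldOn X V →
    ContMDiffOn (𝓡 (2 * n + 1)) 𝓘(ℝ, ℂ) ∞ (fun p => ϑ α p (X p)) V
  θ_reeb : ∀ p ∈ U, S.θ p (reeb p) = 1
  reeb_contract : ∀ V : Set M, IsOpen V → V ⊆ U → ∀ X, SmoothFieldOn X V → ∀ p ∈ V,
    (complexify S.θ).extd (CField.ofReal reeb) (CField.ofReal X) p = 0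
  Z_oneZero : ∀ α, IsOneZeroOn S.θ S.J (Z α) U
  ϑ_reeb : ∀ α, ∀ p ∈ U, ϑ α p (reeb p) = 0
  ϑ_Z : ∀ α β, ∀ p ∈ U, (ϑ α).ap (Z β) p = if α = β then 1 else 0
  ϑ_conj_Z : ∀ α β, ∀ p ∈ U, (ϑ α).ap (Z β).conj p = 0

namespace AdmissibleFrame

variable {S : Pseudohermitian n M} {U : Set M} (F : AdmissibleFrame S U)

/-- The Reeb field as a complex vector field. -/
def T : CField n M := CField.ofReal F.reeb

/-- `Z_{ᾱ}`, the conjugate of `Z_α`. -/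
def Zbar (α : Fin n) : CField n M := (F.Z α).conj

/-- The Levi form `h_{αβ̄}`, from `dθ = i h_{αβ̄} θ^α ∧ θ^{β̄}`. -/
def h (α β : Fin n) (p : M) : ℂ :=
  -Complex.I * (complexify S.θ).extd (F.Z α) (F.Zbar β) p

/-- The inverse `h^{αβ̄}` of the Levi form: `∑_β h^{αβ̄} h_{γβ̄} = δ^α_γ`. -/
def hInv (α β : Fin n) (p : M) : ℂ :=
  (Matrix.of fun a b => F.h a b p)⁻¹ β α

/-! ### The Tanaka–Webster connection

The connection forms `ω_α^β` and the torsion `A_{αβ}` are determined by Webster's relations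

* `dθ^β = θ^α ∧ ω_α^β + θ ∧ τ^β`, where `τ_α = A_{αβ} θ^β`,
* `ω_{αβ̄} + ω_{β̄α} = dh_{αβ̄}`,
* `A_{αβ} = A_{βα}`.

Evaluating the first relation on `(Z_{γ̄}, Z_α)`, `(T, Z_α)` and `(T, Z_{γ̄})`, where
`dθ^β(V, W) = -θ^β([V, W])` for frame fields `V`, `W`, and the second one on `Z_γ`,
gives the four definitions below. -/

/-- `ω_α^β(Z_{γ̄}) = θ^β([Z_{γ̄}, Z_α])`. -/
def connBar (γ α β : Fin n) (p : M) : ℂ := (F.ϑ β).ap ((F.Zbar γ).bracket (F.Z α)) p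

/-- `ω_α^β(T) = θ^β([T, Z_α])`. -/
def connReeb (α β : Fin n) (p : M) : ℂ := (F.ϑ β).ap (F.T.bracket (F.Z α)) p

/-- `ω_α^β(Z_γ) = h^{βσ̄} ω_{ασ̄}(Z_γ)` with `ω_{ασ̄}(Z_γ) = Z_γ h_{ασ̄} - ω_{σ̄α}(Z_γ)`, where
`ω_{σ̄α}(Z_γ)` is the conjugate of `ω_{σᾱ}(Z_{γ̄}) = h_{μᾱ} ω_σ^μ(Z_{γ̄})`. -/
def connHol (γ α β : Fin n) (p : M) : ℂ :=
  ∑ σ, F.hInv β σ p *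
    ((F.Z γ).D (F.h α σ) p - starRingEnd ℂ (∑ μ, F.h μ α p * F.connBar γ σ μ p))

/-- The connection form `ω_α^β`. -/
def conn (α β : Fin n) : CForm n M := fun p =>
  (∑ γ, (F.connHol γ α β p • F.ϑ γ p + F.connBar γ α β p • CForm.conj (F.ϑ γ) p))
    + F.connReeb α β p • complexify S.θ p

/-- The torsion `A_{αβ}`: the conjugate of `A_{ᾱβ̄} = h_{γᾱ} A^γ_{β̄}`, where
`A^γ_{β̄} = τ^γ(Z_{β̄}) = -θ^γ([T, Z_{β̄}])`. -/
def A (α β : Fin n) (p : M) : ℂ :=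
  starRingEnd ℂ (∑ γ, F.h γ α p * -(F.ϑ γ).ap (F.T.bracket (F.Zbar β)) p)

/-! ### Covariant derivatives of components, and contractions -/

/-- `∇_{β̄} τ_α` for a `(1,0)`-form `τ_α θ^α`. -/
def nablaBarForm (τ : Fin n → M → ℂ) (β α : Fin n) (p : M) : ℂ :=
  (F.Zbar β).D (τ α) p - ∑ σ, (F.conn α σ).ap (F.Zbar β) p * τ σ p

/-- `∇_β τ_{ᾱ}` for a `(0,1)`-form `τ_{ᾱ} θ^{ᾱ}`. -/
def nablaFormBar (τ : Fin n → M → ℂ) (β α : Fin n) (p : M) : ℂ :=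
  (F.Z β).D (τ α) p - ∑ σ, (CForm.conj (F.conn α σ)).ap (F.Z β) p * τ σ p

/-- `∇_{γ̄} B_{αβ}` for a tensor `B_{αβ} θ^α ⊗ θ^β`. -/
def nablaBarTwo (B : Fin n → Fin n → M → ℂ) (γ α β : Fin n) (p : M) : ℂ :=
  (F.Zbar γ).D (B α β) p - ∑ σ, (F.conn α σ).ap (F.Zbar γ) p * B σ β p
    - ∑ σ, (F.conn β σ).ap (F.Zbar γ) p * B α σ p

/-- The divergence `∇^α τ_α = h^{αβ̄} ∇_{β̄} τ_α` of a `(1,0)`-form. -/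
def div (τ : Fin n → M → ℂ) (p : M) : ℂ :=
  ∑ α, ∑ β, F.hInv α β p * F.nablaBarForm τ β α p

/-- The divergence `∇_α τ^α = h^{αβ̄} ∇_α τ_{β̄}` of a `(0,1)`-form `τ_{β̄} θ^{β̄}`. -/
def divBar (τ : Fin n → M → ℂ) (p : M) : ℂ :=
  ∑ α, ∑ β, F.hInv α β p * F.nablaFormBar τ α β p

/-- The divergence `∇_{β̄} v^{β̄}` of a `(0,1)`-vector field `v^{β̄} Z_{β̄}`. -/
def divVecBar (v : Fin n → M → ℂ) (p : M) : ℂ :=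
  ∑ β, ((F.Zbar β).D (v β) p + ∑ σ, (CForm.conj (F.conn σ β)).ap (F.Zbar β) p * v σ p)

/-- `∇_α f`. -/
def grad (f : M → ℂ) (α : Fin n) (p : M) : ℂ := (F.Z α).D f p

/-- `∇_{ᾱ} f`. -/
def gradBar (f : M → ℂ) (α : Fin n) (p : M) : ℂ := (F.Zbar α).D f p

/-- `∇^α f = h^{αβ̄} ∇_{β̄} f`. -/
def gradUp (f : M → ℂ) (α : Fin n) (p : M) : ℂ := ∑ β, F.hInv α β p * F.gradBar f β p

/-- The sublaplacian `Δ_b f = -(∇^α ∇_α f + ∇_α ∇^α f)`. -/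
def sublaplacian (f : M → ℂ) (p : M) : ℂ := -(F.div (F.grad f) p + F.divBar (F.gradBar f) p)

/-- `∇_0 f = T f`. -/
def nabla0 (f : M → ℂ) (p : M) : ℂ := F.T.D f p

/-- `A^{αβ} = h^{αγ̄} h^{βσ̄} A_{γ̄σ̄}`, with `A_{γ̄σ̄}` the conjugate of `A_{γσ}`. -/
def AUp (α β : Fin n) (p : M) : ℂ :=
  ∑ γ, ∑ σ, F.hInv α γ p * F.hInv β σ p * starRingEnd ℂ (F.A γ σ p)

/-- `|A_{αβ}|² = A_{αβ} A^{αβ}`. -/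
def normSqA (p : M) : ℂ := ∑ α, ∑ β, F.A α β p * F.AUp α β p

/-- `∇^β A_{αβ} = h^{βγ̄} ∇_{γ̄} A_{αβ}`. -/
def divA (α : Fin n) (p : M) : ℂ := ∑ β, ∑ γ, F.hInv β γ p * F.nablaBarTwo F.A γ α β p

/-- `Im (∇^α ∇^β A_{αβ})`. -/
def imDivDivA (p : M) : ℂ := ((F.div F.divA p).im : ℂ)

/-! ### Curvature -/

/-- The curvature form `Π_α^β = dω_α^β - ω_α^γ ∧ ω_γ^β`, evaluated on two vector fields. -/
def curvForm (α β : Fin n) (V W : CField n M) (p : M) : ℂ :=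
  (F.conn α β).extd V W p - ∑ γ, CForm.wedge (F.conn α γ) (F.conn γ β) V W p

/-- The curvature `R_α^β_{γδ̄}`, the coefficient of `θ^γ ∧ θ^{δ̄}` in `Π_α^β`. -/
def curv (α β γ δ : Fin n) (p : M) : ℂ := F.curvForm α β (F.Z γ) (F.Zbar δ) p

/-- The pseudohermitian Ricci tensor `R_{αβ̄} = R_γ^γ_{αβ̄}`. -/
def ricci (α β : Fin n) (p : M) : ℂ := ∑ γ, F.curv γ γ α β p

/-- The pseudohermitian scalar curvature `R = R_α^α = h^{αβ̄} R_{αβ̄}`. -/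
def scal (p : M) : ℂ := ∑ α, ∑ β, F.hInv α β p * F.ricci α β p

/-- The trace `P = R / (2(n+1))` of the pseudohermitian Schouten tensor. -/
def schoutenTrace (p : M) : ℂ := F.scal p / (2 * ((n : ℂ) + 1))

/-- The pseudohermitian Schouten tensor
`P_{αβ̄} = (R_{αβ̄} - R h_{αβ̄} / (2(n+1))) / (n+2)`. -/
def schouten (α β : Fin n) (p : M) : ℂ :=
  (F.ricci α β p - F.scal p / (2 * ((n : ℂ) + 1)) * F.h α β p) / ((n : ℂ) + 2)

/-- The tracefree part `P_{αβ̄} - (P/n) h_{αβ̄}` of the Schouten tensor. -/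
def schoutenTF (α β : Fin n) (p : M) : ℂ :=
  F.schouten α β p - F.schoutenTrace p / (n : ℂ) * F.h α β p

/-- The tracefree Schouten tensor with raised indices, `h^{αμ̄} h^{νβ̄} P_{νμ̄}`. -/
def schoutenTFUp (α β : Fin n) (p : M) : ℂ :=
  ∑ μ, ∑ ν, F.hInv α μ p * F.hInv ν β p * F.schoutenTF ν μ p

/-- The squared norm of the tracefree Schouten tensor. -/
def normSqSchoutenTF (p : M) : ℂ := ∑ α, ∑ β, F.schoutenTF α β p * F.schoutenTFUp α β p

/-! ### The CR Paneitz operator -/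

/-- The zeroth order coefficient `Q₄` of the CR Paneitz operator. -/
def Q4 (p : M) : ℂ :=
  2 * ((n : ℂ) + 1) ^ 2 / ((n : ℂ) * ((n : ℂ) + 2)) * F.sublaplacian F.schoutenTrace p
    - 4 / ((n : ℂ) * ((n : ℂ) + 2)) * F.imDivDivA p
    - 2 * ((n : ℂ) - 1) / (n : ℂ) * F.normSqA p
    - 2 * ((n : ℂ) + 1) / (n : ℂ) * F.normSqSchoutenTF p
    + 2 * ((n : ℂ) - 1) * ((n : ℂ) + 1) ^ 2 / (n : ℂ) ^ 2 * F.schoutenTrace p ^ 2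

/-- The CR Paneitz operator `P₄` on real-valued functions:
`Δ_b² f + ∇_0² f - 4 Im ∇^α(A_{αβ} ∇^β f) + 4 Re ∇_{β̄}(P̊^{αβ̄} ∇_α f)
  - (4(n²-1)/n) Re ∇^β(P ∇_β f) + ((n-1)/2) Q₄ f`, where `P̊` is the tracefree Schouten tensor. -/
def P4 (f : M → ℝ) (p : M) : ℂ :=
  let g : M → ℂ := fun q => (f q : ℂ)
  F.sublaplacian (F.sublaplacian g) p + F.nabla0 (F.nabla0 g) p
    - 4 * ((F.div (fun α q => ∑ β, F.A α β q * F.gradUp g β q) p).im : ℂ)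
    + 4 * ((F.divVecBar (fun β q => ∑ α, F.schoutenTFUp α β q * F.grad g α q) p).re : ℂ)
    - 4 * ((n : ℂ) ^ 2 - 1) / (n : ℂ)
        * ((F.div (fun β q => F.schoutenTrace q * F.grad g β q) p).re : ℂ)
    + ((n : ℂ) - 1) / 2 * F.Q4 p * g p

end AdmissibleFrame

/-- Pseudo-Einstein: `R_{αβ̄} - (1/n) R h_{αβ̄} = 0` if `n ≥ 2`, and
`∇_α R - i ∇^β A_{αβ} = 0` if `n = 1`. -/
def Pseudohermitian.IsPseudoEinstein (S : Pseudohermitian n M) : Prop :=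
  ∀ (U : Set M) (F : AdmissibleFrame S U), ∀ p ∈ U,
    (2 ≤ n → ∀ α β, F.ricci α β p - 1 / (n : ℂ) * F.scal p * F.h α β p = 0) ∧
    (n = 1 → ∀ α, F.grad F.scal α p - Complex.I * F.divA α p = 0)

end Structures

/-! ### The `Q'`-curvature -/

/-- A linear combination of the scalar invariants `Δ_b R`, `Im ∇^α ∇^β A_{αβ}`, `|A|²`, `|P̊|²`
and `R²` whose coefficients are rational functions of the dimension parameter, written over a
common denominator. -/
structure DimExpr where
  /-- numerators -/
  num : Fin 5 → Polynomial ℝ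
  /-- common denominator -/
  den : Polynomial ℝ

/-- The coefficient number `i` of `E` at the dimension `n`. -/
def DimExpr.coeff (E : DimExpr) (n : ℕ) (i : Fin 5) : ℂ :=
  (((E.num i).eval (n : ℝ) / E.den.eval (n : ℝ) : ℝ) : ℂ)

/-- The value of `E` on a pseudohermitian manifold of CR dimension `n`. -/
def DimExpr.value (E : DimExpr) {n : ℕ} {M : Type u} [TopologicalSpace M]
    [ChartedSpace (Model n) M] [IsManifold (𝓡 (2 * n + 1)) ∞ M]
    {S : Pseudohermitian n M} {U : Set M} (F : AdmissibleFrame S U) (p : M) : ℂ :=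
  E.coeff n 0 * F.sublaplacian F.scal p + E.coeff n 1 * F.imDivDivA p
    + E.coeff n 2 * F.normSqA p + E.coeff n 3 * F.normSqSchoutenTF p
    + E.coeff n 4 * F.scal p ^ 2

/-- `E` has no pole at any dimension `n ≥ 1` (in particular none at `n = 1`) and computes
`4/(n-1)² P₄(1)` on all pseudo-Einstein manifolds of all CR dimensions `n ≥ 2`. -/
def DimExpr.RepresentsQPrime (E : DimExpr) : Prop :=
  (∀ k : ℕ, 1 ≤ k → E.den.eval (k : ℝ) ≠ 0) ∧
  ∀ (k : ℕ), 2 ≤ k → ∀ (N : Type u) [TopologicalSpace N] [ChartedSpace (Model k) N]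
    [IsManifold (𝓡 (2 * k + 1)) ∞ N] (S : Pseudohermitian k N), S.IsPseudoEinstein →
    ∀ (U : Set N) (F : AdmissibleFrame S U), ∀ p ∈ U,
      E.value F p = 4 / ((k : ℂ) - 1) ^ 2 * F.P4 (fun _ => 1) p

/-- `q` is the `Q'`-curvature over `U`.  For `n ≠ 1` this means `q = 4/(n-1)² P₄(1)`.  For `n = 1`
it means that `q` is the formal limit of that expression as `n → 1`, by continuation in the
dimension: `q` is the value at `n = 1` of an expression whose coefficients are rational in the
dimension without pole at `n = 1`, and which computes `4/(n-1)² P₄(1)` on all pseudo-Einstein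
manifolds of CR dimension `n ≥ 2`. -/
def AdmissibleFrame.IsQPrime {n : ℕ} {M : Type u} [TopologicalSpace M]
    [ChartedSpace (Model n) M] [IsManifold (𝓡 (2 * n + 1)) ∞ M]
    {S : Pseudohermitian n M} {U : Set M} (F : AdmissibleFrame S U) (q : M → ℂ) : Prop :=
  (n ≠ 1 → ∀ p ∈ U, q p = 4 / ((n : ℂ) - 1) ^ 2 * F.P4 (fun _ => 1) p) ∧
  (n = 1 → ∃ E : DimExpr, DimExpr.RepresentsQPrime.{u} E ∧ ∀ p ∈ U, q p = E.value F p)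

end CRGeometry

end

/-!
On a pseudo-Einstein manifold of CR dimension `n ≥ 2` the Ricci tensor is `(R / n) h`. The
differential of the trace `ω_α^α` of the connection form is the trace of the curvature: its
`θ^α ∧ θ^β̄` coefficient is the Ricci tensor, its `θ^α ∧ θ` coefficient the divergence of the
torsion, and its `(2, 0)` and `(0, 2)` parts vanish. Hence the `θ^α ∧ θ^β ∧ θ^γ̄` coefficient of
`d (d ω_α^α) = 0` yields, as in Schur's lemma, `∇_α R = i n ∇^β A_{αβ}`, and then
`Δ_b R = 2 n Im ∇^α ∇^β A_{αβ}`.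

All derivative terms of `P₄ 1` vanish, so `P₄ 1 = (n - 1) / 2 * Q₄`, and the trace-free Schouten
tensor is zero. After substituting for the second divergence of the torsion in `Q₄`, the second
factor `n - 1` splits off, so `4 / (n - 1) ^ 2 * P₄ 1` is a combination of `Δ_b R`, `|A|²` and
`R²` whose coefficients have no pole at `n = 1`.
-/

noncomputable section

namespace CRGeometry

universe u

section FrameAlgebra

open Matrix

section MatrixDerivation

variable {R A ι : Type*} [CommRing R] [CommRing A] [Algebra R A] [Fintype ι]
  (D : Derivation R A A)

theorem map_derivation_mul (P Q : Matrix ι ι A) :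
    (P * Q).map D = P.map D * Q + P * Q.map D := by
  ext i j
  simp only [map_apply, mul_apply, Matrix.add_apply, map_sum, Derivation.leibniz, smul_eq_mul,
    Finset.sum_add_distrib]
  rw [add_comm]
  congr 1
  exact Finset.sum_congr rfl fun _ _ => mul_comm _ _

theorem derivation_trace (P : Matrix ι ι A) : D P.trace = (P.map D).trace :=
  map_sum D _ _

theorem map_derivation_inverse [DecidableEq ι] {P Q : Matrix ι ι A} (hQP : Q * P = 1) :
    Q.map D = -(Q * P.map D * Q) := by
  have hPQ : P * Q = 1 := mul_eq_one_comm.mp hQP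
  have map_one : (1 : Matrix ι ι A).map D = 0 := by
    ext i j
    simp only [map_apply, one_apply, Matrix.zero_apply]
    split_ifs <;> simp
  have leibniz : Q.map D * P + Q * P.map D = 0 := by
    rw [← map_derivation_mul, hQP, map_one]
  calc Q.map D = Q.map D * P * Q := by rw [Matrix.mul_assoc, hPQ, Matrix.mul_one]
    _ = -(Q * P.map D * Q) := by rw [eq_neg_of_add_eq_zero_left leibniz, Matrix.neg_mul]

end MatrixDerivation

section Jacobi

variable {R κ A : Type*} [Fintype κ] [CommRing R] [CommRing A] [Algebra R A]

theorem sum_jacobiator_mul {E : κ → Derivation R A A} {c : κ → κ → κ → A}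
    (commutator : ∀ i j f, E i (E j f) - E j (E i f) = ∑ k, c i j k * E k f) (i j k : κ) (f : A) :
    ∑ l, (E i (c j k l) + E j (c k i l) + E k (c i j l)
      + ∑ m, (c j k m * c i m l + c k i m * c j m l + c i j m * c k m l)) * E l f = 0 := by
  have commutator_commutator (i j k : κ) :
      E i (E j (E k f) - E k (E j f)) - (E j (E k (E i f)) - E k (E j (E i f)))
        = ∑ l, (E i (c j k l) + ∑ m, c j k m * c i m l) * E l f := by
    calc _ = ∑ m, E i (c j k m) * E m f + ∑ m, c j k m * (E i (E m f) - E m (E i f)) := by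
          rw [commutator, commutator, map_sum]
          simp only [Derivation.leibniz, smul_eq_mul, mul_sub, Finset.sum_add_distrib,
            Finset.sum_sub_distrib, mul_comm (E _ f)]
          ring
      _ = _ := by
          simp only [commutator, add_mul, Finset.sum_add_distrib, Finset.mul_sum, Finset.sum_mul,
            mul_assoc]
          rw [Finset.sum_comm]
  have cyclic_sum := congrArg₂ (· + ·) (congrArg₂ (· + ·) (commutator_commutator i j k)
    (commutator_commutator j k i)) (commutator_commutator k i j)
  simp only [map_sub, add_mul, Finset.sum_add_distrib] at cyclic_sum ⊢
  linear_combination -cyclic_sum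

end Jacobi

/-- A frame of derivations of `A` that is closed under commutators: `[E i, E j] = ∑ k, c i j k E k`,
where the coefficients satisfy the Jacobi identity. The Jacobi identity is a field since the
derivations need not be independent. -/
structure DerivationFrame (R κ A : Type*) [Fintype κ] [CommRing R] [CommRing A] [Algebra R A] where
  /-- the frame -/
  E : κ → Derivation R A A
  /-- the structure functions -/
  c : κ → κ → κ → A
  c_self : ∀ i k, c i i k = 0
  c_swap : ∀ i j k, c i j k = -c j i k
  commutator : ∀ i j f, E i (E j f) - E j (E i f) = ∑ k, c i j k * E k f
  jacobi : ∀ i j k l, E i (c j k l) + E j (c k i l) + E k (c i j l)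
    + ∑ m, (c j k m * c i m l + c k i m * c j m l + c i j m * c k m l) = 0

namespace DerivationFrame

variable {R κ A : Type*} [Fintype κ] [CommRing R] [CommRing A] [Algebra R A]
  (F : DerivationFrame R κ A)

/-- The exterior derivative of the `1`-form with components `w`, evaluated on the frame. -/
def extd (w : κ → A) (i j : κ) : A :=
  F.E i (w j) - F.E j (w i) - ∑ k, F.c i j k * w k

theorem extd_swap (w : κ → A) (i j : κ) : F.extd w i j = -F.extd w j i := by
  simp only [extd, F.c_swap i j, neg_mul, Finset.sum_neg_distrib]
  ring

theorem extd_add (v w : κ → A) (i j : κ) :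
    F.extd (fun k => v k + w k) i j = F.extd v i j + F.extd w i j := by
  simp only [extd, map_add, mul_add, Finset.sum_add_distrib]
  ring

theorem sum_c_mul_extd (w : κ → A) (i j k : κ) :
    ∑ m, F.c i j m * F.extd w m k = ∑ m, F.c i j m * F.E m (w k) - ∑ m, F.c i j m * F.E k (w m)
      + ∑ l, (∑ m, F.c i j m * F.c k m l) * w l := by
  have swap (m : κ) : ∑ l, F.c m k l * w l = -∑ l, F.c k m l * w l := by
    simp only [F.c_swap m k, neg_mul, Finset.sum_neg_distrib]
  simp only [extd, swap, sub_neg_eq_add, mul_add, mul_sub, Finset.sum_add_distrib,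
    Finset.sum_sub_distrib, Finset.mul_sum, Finset.sum_mul, mul_assoc]
  rw [Finset.sum_comm]

/-- Cartan's formula for `d(dw) = 0`. -/
theorem extd_extd (w : κ → A) (i j k : κ) :
    F.E i (F.extd w j k) + F.E j (F.extd w k i) + F.E k (F.extd w i j)
      = ∑ m, (F.c i j m * F.extd w m k + F.c j k m * F.extd w m i
          + F.c k i m * F.extd w m j) := by
  have jacobi_contracted : ∑ l, (F.E i (F.c j k l) + F.E j (F.c k i l) + F.E k (F.c i j l)
      + ∑ m, (F.c j k m * F.c i m l + F.c k i m * F.c j m l + F.c i j m * F.c k m l)) * w l = 0 :=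
    Finset.sum_eq_zero fun l _ => by rw [F.jacobi, zero_mul]
  have E_mul_comm (a b d : κ) : ∑ l, w l * F.E d (F.c a b l) = ∑ l, F.E d (F.c a b l) * w l :=
    Finset.sum_congr rfl fun _ _ => mul_comm _ _
  simp only [Finset.sum_add_distrib, sum_c_mul_extd]
  simp only [Finset.sum_add_distrib, add_mul] at jacobi_contracted
  simp only [extd, map_sub, map_sum, Derivation.leibniz, smul_eq_mul, Finset.sum_add_distrib,
    E_mul_comm]
  linear_combination F.commutator i j (w k) + F.commutator j k (w i) + F.commutator k i (w j)
    - jacobi_contracted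

section Matrix

variable {ι : Type*} [Fintype ι]

/-- The curvature `dΓ - Γ ∧ Γ` of a matrix of `1`-forms with components `Γ i`. -/
def curv (Γ : κ → Matrix ι ι A) (i j : κ) : Matrix ι ι A :=
  (Γ j).map (F.E i) - (Γ i).map (F.E j) - ∑ k, F.c i j k • Γ k - (Γ i * Γ j - Γ j * Γ i)

theorem trace_curv (Γ : κ → Matrix ι ι A) (i j : κ) :
    (F.curv Γ i j).trace = F.extd (fun k => (Γ k).trace) i j := by
  simp only [curv, extd, derivation_trace, trace_sub, trace_sum, trace_smul, smul_eq_mul,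
    trace_mul_comm (Γ i), sub_self, sub_zero]

/-- The form `tr (P⁻¹ dP)` is closed, being the differential of `log (det P)`. -/
theorem extd_trace_inverse_mul_map [DecidableEq ι] {P Q : Matrix ι ι A} (hQP : Q * P = 1)
    (i j : κ) : F.extd (fun k => (Q * P.map (F.E k)).trace) i j = 0 := by
  have E_trace (i j : κ) : F.E i (Q * P.map (F.E j)).trace
      = -(Q * P.map (F.E i) * Q * P.map (F.E j)).trace
        + (Q * (P.map (F.E j)).map (F.E i)).trace := by
    rw [derivation_trace, map_derivation_mul, map_derivation_inverse _ hQP, trace_add,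
      Matrix.neg_mul, trace_neg]
  have trace_swap : (Q * P.map (F.E i) * Q * P.map (F.E j)).trace
      = (Q * P.map (F.E j) * Q * P.map (F.E i)).trace := by
    rw [Matrix.mul_assoc, trace_mul_comm, ← Matrix.mul_assoc]
  have map_commutator : (P.map (F.E j)).map (F.E i) - (P.map (F.E i)).map (F.E j)
      = ∑ k, F.c i j k • P.map (F.E k) := by
    ext a b
    simp [F.commutator, Matrix.sum_apply]
  have trace_commutator := congrArg (fun X => (Q * X).trace) map_commutator
  simp only [Matrix.mul_sub, trace_sub, Matrix.mul_sum, Matrix.mul_smul, trace_sum, trace_smul,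
    smul_eq_mul] at trace_commutator
  simp only [extd, E_trace, trace_swap]
  linear_combination trace_commutator

end Matrix

end DerivationFrame

/-- Indices of a frame `T, Z_α, Z_{ᾱ}`, where `α` ranges over `ι`. -/
abbrev FrameIndex (ι : Type*) : Type _ := Unit ⊕ (ι ⊕ ι)

namespace FrameIndex

variable {ι : Type*}

/-- The index of `T`. -/
abbrev t : FrameIndex ι := Sum.inl ()

/-- The index of `Z_α`. -/
abbrev z (a : ι) : FrameIndex ι := Sum.inr (Sum.inl a)

/-- The index of `Z_{ᾱ}`. -/
abbrev zb (a : ι) : FrameIndex ι := Sum.inr (Sum.inr a)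

/-- The index of the conjugate of a frame field. -/
def bar : FrameIndex ι → FrameIndex ι := Sum.map id Sum.swap

@[simp] theorem bar_t : bar (t : FrameIndex ι) = t := rfl
@[simp] theorem bar_z (a : ι) : bar (z a) = zb a := rfl
@[simp] theorem bar_zb (a : ι) : bar (zb a) = z a := rfl

@[simp] theorem bar_bar (i : FrameIndex ι) : bar (bar i) = i := by
  rcases i with _ | _ | _ <;> rfl

variable [Fintype ι] {A : Type*} [AddCommMonoid A]

theorem sum_bar (f : FrameIndex ι → A) : ∑ i, f (bar i) = ∑ i, f i :=
  Fintype.sum_equiv ⟨bar, bar, bar_bar, bar_bar⟩ _ _ fun _ => rfl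

theorem sum_eq (f : FrameIndex ι → A) : ∑ i, f i = f t + (∑ a, f (z a) + ∑ a, f (zb a)) := by
  simp [Fintype.sum_sum_type]

end FrameIndex

open FrameIndex

/-- An algebraic model of an admissible frame of a pseudohermitian manifold: the derivations `E i`
of an algebra `A` of complex functions along `T, Z_α, Z_{ᾱ}`. The conditions on the structure
functions say that `T^{1,0}` is involutive, that `T` is the Reeb field, and that the Levi form is
nondegenerate. -/
structure CRFrame (ι A : Type*) [Fintype ι] [DecidableEq ι] [CommRing A] [StarRing A] [Algebra ℂ A]
    extends DerivationFrame ℂ (FrameIndex ι) A where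
  /-- the inverse of the matrix of the Levi form -/
  leviInv : Matrix ι ι A
  E_star : ∀ i f, E (bar i) (star f) = star (E i f)
  c_star : ∀ i j k, c (bar i) (bar j) (bar k) = star (c i j k)
  c_z_z_t : ∀ a b, c (z a) (z b) t = 0
  c_z_z_zb : ∀ a b d, c (z a) (z b) (zb d) = 0
  c_t_t : ∀ i, c t i t = 0
  leviInv_mul : leviInv * (Complex.I • Matrix.of fun a b => c (z a) (zb b) t) = 1

namespace CRFrame

variable {ι A : Type*} [Fintype ι] [DecidableEq ι] [CommRing A] [StarRing A] [Algebra ℂ A]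
  (F : CRFrame ι A)

/-- The matrix `θ([Z_α, Z_{β̄}]) = -i h_{αβ̄}`. -/
def leviBracket : Matrix ι ι A := Matrix.of fun a b => F.c (z a) (zb b) t

/-- The matrix `h_{αβ̄}` of the Levi form. -/
def levi : Matrix ι ι A := Complex.I • F.leviBracket

/-- The matrix `θ^β([E_i, Z_α])`, which is `ω_α^β(E_i)` unless `E_i` is of type `(1,0)`. -/
def bracketZ (i : FrameIndex ι) : Matrix ι ι A := Matrix.of fun a b => F.c i (z a) (z b)

/-- The Tanaka–Webster connection matrix `ω_α^β`, with rows indexed by `α`. On `T^{1,0}` it is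
determined by compatibility with the Levi form. -/
def conn : FrameIndex ι → Matrix ι ι A
  | Sum.inl _ => F.bracketZ t
  | Sum.inr (Sum.inl g) =>
    (F.levi.map (F.E (z g)) - F.levi * (F.bracketZ (zb g))ᴴ) * F.leviInv
  | Sum.inr (Sum.inr g) => F.bracketZ (zb g)

/-- The matrix `θ^β([T, Z_{ᾱ}])`, that is, `-A^β_{ᾱ}`. -/
def reebZbar : Matrix ι ι A := Matrix.of fun a b => F.c t (zb a) (z b)

/-- The torsion `A_{αβ}`. -/
def torsion : Matrix ι ι A := -(F.reebZbar * F.levi)ᴴ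

/-- The covariant derivative of the torsion along `E_i`. -/
def nablaTorsion (i : FrameIndex ι) : Matrix ι ι A :=
  F.torsion.map (F.E i) - F.conn i * F.torsion - F.torsion * (F.conn i)ᵀ

/-- The divergence `∇^β A_{αβ}` of the torsion. -/
def divTorsion (a : ι) : A := ∑ g, (F.nablaTorsion (zb g) * F.leviInvᵀ) a g

/-- The Ricci tensor `R_{αβ̄}`. -/
def ricci : Matrix ι ι A := Matrix.of fun a b => (F.curv F.conn (z a) (zb b)).trace

/-- The scalar curvature `R`. -/
def scal : A := (F.leviInv * F.ricci).trace

theorem leviInv_mul_levi : F.leviInv * F.levi = 1 := F.leviInv_mul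

theorem levi_mul_leviInv : F.levi * F.leviInv = 1 := mul_eq_one_comm.mp F.leviInv_mul

/-! ### Components of the structure functions -/

theorem c_i_t_t (i : FrameIndex ι) : F.c i t t = 0 := by rw [F.c_swap, F.c_t_t, neg_zero]

theorem c_zb_zb_t (a b : ι) : F.c (zb a) (zb b) t = 0 := by
  simpa [F.c_z_z_t] using F.c_star (z a) (z b) t

theorem c_zb_zb_z (a b d : ι) : F.c (zb a) (zb b) (z d) = 0 := by
  simpa [F.c_z_z_zb] using F.c_star (z a) (z b) (zb d)

theorem c_z_zb_t (a b : ι) : F.c (z a) (zb b) t = F.leviBracket a b := rfl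

theorem c_zb_z_t (a b : ι) : F.c (zb b) (z a) t = -F.leviBracket a b := F.c_swap _ _ _

theorem c_t_z_z (a b : ι) : F.c t (z a) (z b) = F.conn t a b := rfl

theorem c_zb_z_z (g a b : ι) : F.c (zb g) (z a) (z b) = F.conn (zb g) a b := rfl

theorem c_z_zb_z (g a b : ι) : F.c (z a) (zb g) (z b) = -F.conn (zb g) a b := F.c_swap _ _ _

theorem c_z_zb_zb (g a b : ι) : F.c (z g) (zb a) (zb b) = star (F.conn (zb g) a b) :=
  F.c_star (zb g) (z a) (z b)

theorem c_zb_z_zb (g a b : ι) : F.c (zb a) (z g) (zb b) = -star (F.conn (zb g) a b) := by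
  rw [F.c_swap, c_z_zb_zb]

theorem c_t_zb_zb (a b : ι) : F.c t (zb a) (zb b) = star (F.conn t a b) :=
  F.c_star t (z a) (z b)

theorem c_zb_t_zb (a b : ι) : F.c (zb a) t (zb b) = -star (F.conn t a b) := by
  rw [F.c_swap, c_t_zb_zb]

theorem c_t_zb_z (a b : ι) : F.c t (zb a) (z b) = F.reebZbar a b := rfl

theorem c_zb_t_z (a b : ι) : F.c (zb a) t (z b) = -F.reebZbar a b := F.c_swap _ _ _

/-! ### Conjugation -/

theorem map_E_conjTranspose (i : FrameIndex ι) (P : Matrix ι ι A) :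
    Pᴴ.map (F.E (bar i)) = (P.map (F.E i))ᴴ := by
  ext a b
  exact F.E_star i _

theorem star_E_bar (i : FrameIndex ι) (f : A) : star (F.E (bar i) f) = F.E i (star f) := by
  rw [← F.E_star, bar_bar]

theorem star_extd (w : FrameIndex ι → A) (i j : FrameIndex ι) :
    star (F.extd w (bar i) (bar j)) = F.extd (fun k => star (w (bar k))) i j := by
  simp only [DerivationFrame.extd, star_sub, star_sum, star_mul', star_E_bar]
  congr 1
  rw [← sum_bar]
  exact Finset.sum_congr rfl fun k _ => by rw [← F.c_star, bar_bar, bar_bar, bar_bar]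

theorem conjTranspose_leviBracket : F.leviBracketᴴ = -F.leviBracket := by
  ext a b
  exact (F.c_star (z b) (zb a) t).symm.trans (F.c_swap _ _ _)

theorem conjTranspose_levi [StarModule ℂ A] : F.leviᴴ = F.levi := by
  rw [levi, conjTranspose_smul, conjTranspose_leviBracket, Complex.star_def, Complex.conj_I,
    neg_smul_neg]

theorem conjTranspose_leviInv [StarModule ℂ A] : F.leviInvᴴ = F.leviInv := by
  have left_inverse : F.leviInvᴴ * F.levi = 1 := by
    rw [← F.conjTranspose_levi, ← conjTranspose_mul, levi_mul_leviInv, conjTranspose_one]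
  exact left_inv_eq_right_inv left_inverse F.levi_mul_leviInv

theorem star_levi [StarModule ℂ A] (a b : ι) : star (F.levi a b) = F.levi b a :=
  congrFun₂ F.conjTranspose_levi b a

/-! ### Webster's structure equations, as components of the Jacobi identity -/

theorem reebZbar_mul_leviBracket_transpose :
    (F.reebZbar * F.leviBracket)ᵀ = F.reebZbar * F.leviBracket := by
  ext a b
  have jacobi := F.jacobi t (zb a) (zb b) t
  simp only [sum_eq, c_zb_zb_t, F.c_t_t, c_i_t_t, c_zb_t_z, c_t_zb_z, c_zb_z_t, map_zero,
    mul_zero, neg_mul, mul_neg, neg_neg, zero_add, add_zero, Finset.sum_const_zero,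
    Finset.sum_add_distrib, Finset.sum_neg_distrib] at jacobi
  simp only [transpose_apply, mul_apply]
  linear_combination jacobi

theorem map_E_t_leviBracket : F.leviBracket.map (F.E t)
    = F.conn t * F.leviBracket + F.leviBracket * (F.conn t)ᴴ := by
  ext a b
  have jacobi := F.jacobi t (z a) (zb b) t
  simp only [sum_eq, c_zb_zb_t, F.c_t_t, c_i_t_t, c_zb_t_zb, c_t_z_z, c_zb_z_t, F.c_z_z_t, c_z_zb_t,
    map_zero, mul_zero, neg_mul, mul_neg, zero_add, add_zero, Finset.sum_const_zero,
    Finset.sum_add_distrib, Finset.sum_neg_distrib] at jacobi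
  simp only [map_apply, Matrix.add_apply, mul_apply, conjTranspose_apply,
    mul_comm (F.leviBracket a _)]
  linear_combination jacobi

theorem curv_zb_zb (g d a b : ι) : F.curv F.conn (zb g) (zb d) a b
    = F.reebZbar d b * F.leviBracket a g - F.reebZbar g b * F.leviBracket a d := by
  have jacobi := F.jacobi (zb g) (zb d) (z a) (z b)
  simp only [sum_eq, c_zb_zb_z, c_zb_zb_t, c_zb_t_z, c_zb_z_t, c_z_zb_z, c_zb_z_z, c_z_zb_t,
    map_zero, map_neg, zero_mul, mul_zero, zero_add, add_zero, neg_mul, mul_neg,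
    Finset.sum_const_zero, Finset.sum_add_distrib, Finset.sum_neg_distrib] at jacobi
  simp only [DerivationFrame.curv, sum_eq, c_zb_zb_t, c_zb_zb_z, zero_smul, zero_add, mul_apply,
    Finset.sum_const_zero, Matrix.sub_apply, Matrix.sum_apply, Matrix.smul_apply, map_apply,
    smul_eq_mul, mul_comm (F.reebZbar _ _)]
  linear_combination jacobi

theorem trace_curv_zb_zb (g d : ι) : (F.curv F.conn (zb g) (zb d)).trace = 0 := by
  have symm := congrFun₂ F.reebZbar_mul_leviBracket_transpose g d
  simp only [transpose_apply, mul_apply] at symm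
  simp only [Matrix.trace, diag_apply, curv_zb_zb, Finset.sum_sub_distrib]
  exact sub_eq_zero.mpr symm

theorem E_z_leviBracket (g a b : ι) :
    F.E (z g) (F.leviBracket a b) - ∑ m, star (F.conn (zb g) b m) * F.leviBracket a m
      - (F.E (z a) (F.leviBracket g b) - ∑ m, star (F.conn (zb a) b m) * F.leviBracket g m)
      = ∑ m, F.c (z g) (z a) (z m) * F.leviBracket m b := by
  have jacobi := F.jacobi (z g) (z a) (zb b) t
  simp only [sum_eq, c_zb_zb_t, c_i_t_t, c_zb_z_t, F.c_z_z_t, c_z_zb_t, F.c_z_z_zb, c_zb_z_zb,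
    c_z_zb_zb, map_zero, map_neg, mul_zero, mul_neg, neg_mul, zero_add, add_zero,
    Finset.sum_const_zero, Finset.sum_add_distrib, Finset.sum_neg_distrib] at jacobi
  linear_combination jacobi

theorem E_z_levi (g a b : ι) :
    F.E (z g) (F.levi a b) - ∑ m, star (F.conn (zb g) b m) * F.levi a m
      - (F.E (z a) (F.levi g b) - ∑ m, star (F.conn (zb a) b m) * F.levi g m)
      = ∑ m, F.c (z g) (z a) (z m) * F.levi m b := by
  have scaled := congrArg (Complex.I • ·) (F.E_z_leviBracket g a b)
  simpa only [levi, Matrix.smul_apply, Derivation.map_smul, mul_smul_comm, ← Finset.smul_sum,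
    ← smul_sub] using scaled

variable [StarModule ℂ A]

/-- The connection is compatible with the Levi form, `dh_{αβ̄} = ω_{αβ̄} + ω_{β̄α}`. -/
theorem map_E_levi (i : FrameIndex ι) :
    F.levi.map (F.E i) = F.conn i * F.levi + F.levi * (F.conn (bar i))ᴴ := by
  have hol (g : ι) : F.levi.map (F.E (z g))
      = F.conn (z g) * F.levi + F.levi * (F.conn (zb g))ᴴ := by
    simp only [conn, Matrix.mul_assoc, leviInv_mul_levi, Matrix.mul_one, sub_add_cancel]
  rcases i with _ | g | g
  · calc F.levi.map (F.E t) = Complex.I • F.leviBracket.map (F.E t) := by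
          ext a b
          exact (F.E t).map_smul _ _
      _ = F.conn t * F.levi + F.levi * (F.conn t)ᴴ := by
          rw [map_E_t_leviBracket, smul_add, ← Matrix.mul_smul, ← Matrix.smul_mul, levi]
  · exact hol g
  · have conj_hol := congrArg conjTranspose (hol g)
    rw [← map_E_conjTranspose, conjTranspose_add, conjTranspose_mul, conjTranspose_mul,
      conjTranspose_conjTranspose, conjTranspose_levi] at conj_hol
    rw [add_comm]
    exact conj_hol

/-- The connection has no torsion on `T^{1,0}`. -/
theorem conn_z_sub_conn_z (g a b : ι) :
    F.conn (z g) a b - F.conn (z a) g b = F.c (z g) (z a) (z b) := by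
  have lowered : (F.conn (z g) a - F.conn (z a) g) ᵥ* F.levi = F.c (z g) (z a) ∘ z ᵥ* F.levi := by
    ext s
    have compat (g a : ι) := congrFun₂ (F.map_E_levi (z g)) a s
    simp only [map_apply, Matrix.add_apply, mul_apply, conjTranspose_apply, bar_z,
      mul_comm (F.levi _ _)] at compat
    simp only [Pi.sub_apply, vecMul, dotProduct, Function.comp_apply, sub_mul,
      Finset.sum_sub_distrib, ← E_z_levi, compat]
    ring
  have raised := congrArg (· ᵥ* F.leviInv) lowered
  simp only [vecMul_vecMul, levi_mul_leviInv, vecMul_one] at raised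
  exact congrFun raised b

/-- The covariant derivative `∇_γ A^β_{ᾱ}` of the torsion up to sign, see `reebZbar`. -/
def nablaReebZbar (i : FrameIndex ι) : Matrix ι ι A :=
  F.reebZbar.map (F.E i) - (F.conn (bar i)).map star * F.reebZbar + F.reebZbar * F.conn i

theorem curv_zb_t (g a b : ι) : F.curv F.conn (zb g) t a b = F.nablaReebZbar (z a) g b := by
  have jacobi := F.jacobi (zb g) t (z a) (z b)
  simp only [sum_eq, F.c_self, c_zb_zb_z, c_zb_t_z, c_z_zb_z, c_zb_z_z, c_t_z_z, F.c_t_t, c_i_t_t,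
    c_z_zb_zb, c_zb_t_zb, c_t_zb_z, mul_sub, Finset.sum_sub_distrib, ← conn_z_sub_conn_z,
    zero_mul, mul_zero, zero_add, add_zero, map_neg, Finset.sum_add_distrib, neg_mul, mul_neg,
    neg_neg, Finset.sum_neg_distrib, Finset.sum_const_zero] at jacobi
  simp only [DerivationFrame.curv, nablaReebZbar, bar_z, sum_eq, c_i_t_t, c_zb_t_z, c_zb_t_zb,
    zero_smul, zero_add, mul_apply, neg_smul, Finset.sum_neg_distrib, Matrix.neg_apply,
    Matrix.add_apply, Matrix.sub_apply, Matrix.sum_apply, Matrix.smul_apply, map_apply,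
    smul_eq_mul]
  linear_combination jacobi

theorem torsion_eq : F.torsion = -(F.reebZbar.map star * F.leviᵀ) := by
  have symm : (F.reebZbar * F.levi)ᵀ = F.reebZbar * F.levi := by
    rw [levi, Matrix.mul_smul, transpose_smul, reebZbar_mul_leviBracket_transpose]
  rw [torsion, ← symm]
  ext a b
  simp [mul_apply, mul_comm, star_levi]

/-- Lowering an index commutes with covariant differentiation. -/
theorem nablaTorsion_bar (i : FrameIndex ι) :
    F.nablaTorsion (bar i) = -((F.nablaReebZbar i).map star * F.leviᵀ) := by
  have map_E_levi_transpose : F.leviᵀ.map (F.E (bar i))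
      = F.leviᵀ * (F.conn (bar i))ᵀ + (F.conn i).map star * F.leviᵀ := by
    have transposed := congrArg transpose (F.map_E_levi (bar i))
    rw [bar_bar, transpose_add, transpose_mul, transpose_mul] at transposed
    exact transposed
  have map_star_nabla : (F.nablaReebZbar i).map star = (F.reebZbar.map star).map (F.E (bar i))
      - F.conn (bar i) * F.reebZbar.map star + F.reebZbar.map star * (F.conn i).map star := by
    ext a b
    simp [nablaReebZbar, mul_apply, ← F.E_star, mul_comm]
  have map_neg (P : Matrix ι ι A) (j : FrameIndex ι) : (-P).map (F.E j) = -P.map (F.E j) := by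
    ext a b
    exact (F.E j).map_neg _
  rw [nablaTorsion, torsion_eq, map_star_nabla, map_neg, map_derivation_mul, map_E_levi_transpose]
  noncomm_ring

theorem divTorsion_eq (a : ι) : F.divTorsion a = -∑ g, star (F.nablaReebZbar (z g) a g) := by
  have raised (g : ι) : F.nablaTorsion (zb g) * F.leviInvᵀ
      = -(F.nablaReebZbar (z g)).map star := by
    rw [← bar_z, nablaTorsion_bar, Matrix.neg_mul, Matrix.mul_assoc, ← transpose_mul,
      leviInv_mul_levi, transpose_one, Matrix.mul_one]
  simp only [divTorsion, raised, Matrix.neg_apply, map_apply, Finset.sum_neg_distrib]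

/-! ### The trace of the connection form -/

/-- The sum of the trace of the connection and its conjugate is the logarithmic differential of the
determinant of the Levi form. -/
theorem trace_conn_add_star (i : FrameIndex ι) :
    (F.conn i).trace + star (F.conn (bar i)).trace
      = (F.leviInv * F.levi.map (F.E i)).trace := by
  rw [map_E_levi, Matrix.mul_add, trace_add, trace_mul_comm, Matrix.mul_assoc, levi_mul_leviInv,
    Matrix.mul_one, ← Matrix.mul_assoc, leviInv_mul_levi, Matrix.one_mul, trace_conjTranspose]

theorem trace_curv_bar (i j : FrameIndex ι) :
    (F.curv F.conn i j).trace = -star (F.curv F.conn (bar i) (bar j)).trace := by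
  have closed := F.extd_trace_inverse_mul_map F.leviInv_mul_levi i j
  simp only [← trace_conn_add_star] at closed
  rw [F.extd_add] at closed
  rw [F.trace_curv, F.trace_curv, star_extd]
  exact eq_neg_of_add_eq_zero_left closed

theorem conjTranspose_ricci : F.ricciᴴ = F.ricci := by
  ext a b
  rw [conjTranspose_apply, ricci, of_apply, of_apply, F.trace_curv_bar (z a), F.trace_curv,
    F.extd_swap, F.trace_curv, star_neg]
  simp

theorem star_scal : star F.scal = F.scal := by
  rw [scal, ← trace_conjTranspose, conjTranspose_mul, conjTranspose_ricci, conjTranspose_leviInv,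
    trace_mul_comm]

theorem trace_curv_z_z (g d : ι) : (F.curv F.conn (z g) (z d)).trace = 0 := by
  rw [trace_curv_bar, bar_z, bar_z, trace_curv_zb_zb, star_zero, neg_zero]

theorem trace_curv_z_t (a : ι) : (F.curv F.conn (z a) t).trace = F.divTorsion a := by
  rw [trace_curv_bar, divTorsion_eq, ← star_sum]
  simp only [bar_z, bar_t, Matrix.trace, diag_apply, curv_zb_t]

/-! ### Schur's lemma -/

/-- The identity `d(dω_α^α) = 0` on `Z_α, Z_β, Z_{γ̄}`. -/
theorem E_sub_divTorsion_mul_levi_comm {f : A} (ricci_eq : F.ricci = f • F.levi) (a b g : ι) :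
    (F.E (z a) f - Complex.I • F.divTorsion a) * F.levi b g
      = (F.E (z b) f - Complex.I • F.divTorsion b) * F.levi a g := by
  have z_zb (a b : ι) : F.extd (fun k => (F.conn k).trace) (z a) (zb b) = f * F.levi a b := by
    rw [← F.trace_curv]
    exact congrFun₂ ricci_eq a b
  have zb_z (a b : ι) : F.extd (fun k => (F.conn k).trace) (zb b) (z a) = -(f * F.levi a b) := by
    rw [F.extd_swap, z_zb]
  have z_z (a b : ι) : F.extd (fun k => (F.conn k).trace) (z a) (z b) = 0 := by
    rw [← F.trace_curv, trace_curv_z_z]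
  have t_z (a : ι) : F.extd (fun k => (F.conn k).trace) t (z a) = -F.divTorsion a := by
    rw [F.extd_swap, ← F.trace_curv, trace_curv_z_t]
  have leviBracket_eq (a b : ι) : F.leviBracket a b = -(Complex.I • F.levi a b) := by
    simp [levi, smul_smul]
  have closed := F.extd_extd (fun k => (F.conn k).trace) (z a) (z b) (zb g)
  have torsion_free := congrArg (f * ·) (F.E_z_levi a b g)
  simp only [sum_eq, z_zb, zb_z, z_z, t_z, F.c_z_z_t, F.c_z_z_zb, c_z_zb_t, c_zb_z_t, c_z_zb_zb,
    c_zb_z_zb, leviBracket_eq, zero_mul, mul_zero, zero_add, add_zero, map_zero, map_neg,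
    Derivation.leibniz, smul_eq_mul, Finset.sum_const_zero, Finset.sum_add_distrib, neg_mul,
    mul_neg, neg_neg, Finset.sum_neg_distrib] at closed
  simp only [mul_sub, Finset.mul_sum, mul_left_comm f] at torsion_free
  simp only [Algebra.smul_def] at closed ⊢
  linear_combination closed - torsion_free

theorem E_eq_divTorsion_of_ricci_eq [Nontrivial ι] {f : A} (ricci_eq : F.ricci = f • F.levi)
    (a : ι) : F.E (z a) f = Complex.I • F.divTorsion a := by
  obtain ⟨b, hb⟩ := exists_ne a
  have levi_mul (c d : ι) : ∑ g, F.levi c g * F.leviInv g d = (1 : Matrix ι ι A) c d :=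
    congrFun₂ F.levi_mul_leviInv c d
  have contracted := Finset.sum_congr rfl fun g (_ : g ∈ Finset.univ) =>
    congrArg (· * F.leviInv g b) (F.E_sub_divTorsion_mul_levi_comm ricci_eq a b g)
  simp only [mul_assoc, ← Finset.mul_sum, levi_mul, one_apply_eq, one_apply_ne hb.symm, mul_one,
    mul_zero] at contracted
  exact sub_eq_zero.mp contracted

end CRFrame

end FrameAlgebra

section RealCalculus

variable {n : ℕ} {M : Type u} [TopologicalSpace M] [ChartedSpace (Model n) M]

variable (n M) in
/-- Real vector fields on `M`, without regularity. -/
abbrev VField : Type u := (p : M) → TangentSpace (𝓡 (2 * n + 1)) p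

local notation "𝓛[" X "," Y "]" => VectorField.mlieBracket (𝓡 (2 * _ + 1)) X Y

variable {E : Type*} [NormedAddCommGroup E] [NormedSpace ℝ E] {X Y W : VField n M}
  {f g : M → E} {U V : Set M} {p : M}

/-- The derivative of a vector-valued function along a real vector field. -/
def dirDeriv (X : VField n M) (f : M → E) (p : M) : E := mvfderiv (𝓡 (2 * n + 1)) f p (X p)

variable (n) in
/-- Smooth vector-valued functions on `U`. -/
def SmoothFunOn (f : M → E) (U : Set M) : Prop :=
  ContMDiffOn (𝓡 (2 * n + 1)) 𝓘(ℝ, E) ∞ f U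

theorem SmoothFunOn.mdifferentiableAt (hf : SmoothFunOn n f U) (hU : IsOpen U) (hp : p ∈ U) :
    MDifferentiableAt (𝓡 (2 * n + 1)) 𝓘(ℝ, E) f p :=
  ((hf p hp).contMDiffAt (hU.mem_nhds hp)).mdifferentiableAt (by simp)

theorem SmoothFunOn.congr (hf : SmoothFunOn n f U) (hfg : ∀ p ∈ U, g p = f p) :
    SmoothFunOn n g U :=
  ContMDiffOn.congr hf hfg

theorem SmoothFunOn.mono (hf : SmoothFunOn n f U) (hVU : V ⊆ U) : SmoothFunOn n f V :=
  ContMDiffOn.mono hf hVU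

theorem smoothFunOn_const (z : E) (U : Set M) : SmoothFunOn n (fun _ : M => z) U :=
  contMDiffOn_const

theorem SmoothFunOn.add (hf : SmoothFunOn n f U) (hg : SmoothFunOn n g U) :
    SmoothFunOn n (fun p => f p + g p) U :=
  ContMDiffOn.add hf hg

theorem SmoothFunOn.clm_comp {E' : Type*} [NormedAddCommGroup E'] [NormedSpace ℝ E']
    (L : E →L[ℝ] E') (hf : SmoothFunOn n f U) : SmoothFunOn n (fun p => L (f p)) U :=
  L.contDiff.contMDiff.comp_contMDiffOn hf

theorem SmoothFunOn.mul {f g : M → ℂ} (hf : SmoothFunOn n f U) (hg : SmoothFunOn n g U) :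
    SmoothFunOn n (fun p => f p * g p) U :=
  (contDiff_mul (𝕜 := ℝ) (𝔸 := ℂ)).contMDiff.comp_contMDiffOn (ContMDiffOn.prodMk_space hf hg)

theorem SmoothFunOn.inv {f : M → ℂ} (hf : SmoothFunOn n f U) (hf0 : ∀ p ∈ U, f p ≠ 0) :
    SmoothFunOn n (fun p => (f p)⁻¹) U := fun p hp =>
  ((contDiffAt_inv ℝ (hf0 p hp)).contMDiffAt).comp_contMDiffWithinAt p (hf p hp)

theorem SmoothFunOn.conj {f : M → ℂ} (hf : SmoothFunOn n f U) :
    SmoothFunOn n (fun p => starRingEnd ℂ (f p)) U :=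
  hf.clm_comp (Complex.conjCLE : ℂ →L[ℝ] ℂ)

theorem dirDeriv_congr (X : VField n M) (hU : IsOpen U) (hfg : ∀ p ∈ U, f p = g p) (hp : p ∈ U) :
    dirDeriv X f p = dirDeriv X g p := by
  have eventually_eq : f =ᶠ[nhds p] g := Filter.eventuallyEq_of_mem (hU.mem_nhds hp) hfg
  exact congrArg (fun L : TangentSpace (𝓡 (2 * n + 1)) p →L[ℝ] E => L (X p))
    eventually_eq.mfderiv_eq

theorem dirDeriv_add (X : VField n M) (hf : MDifferentiableAt (𝓡 (2 * n + 1)) 𝓘(ℝ, E) f p)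
    (hg : MDifferentiableAt (𝓡 (2 * n + 1)) 𝓘(ℝ, E) g p) :
    dirDeriv X (fun q => f q + g q) p = dirDeriv X f p + dirDeriv X g p :=
  congrArg (fun L : TangentSpace (𝓡 (2 * n + 1)) p →L[ℝ] E => L (X p)) (mvfderiv_fun_add hf hg)

theorem dirDeriv_mul (X : VField n M) {f g : M → ℂ}
    (hf : MDifferentiableAt (𝓡 (2 * n + 1)) 𝓘(ℝ, ℂ) f p)
    (hg : MDifferentiableAt (𝓡 (2 * n + 1)) 𝓘(ℝ, ℂ) g p) :
    dirDeriv X (fun q => f q * g q) p = f p * dirDeriv X g p + g p * dirDeriv X f p :=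
  congrArg (fun L : TangentSpace (𝓡 (2 * n + 1)) p →L[ℝ] ℂ => L (X p))
    (hf.hasMFDerivAt.mul hg.hasMFDerivAt).mfderiv

theorem dirDeriv_const (X : VField n M) (z : E) (p : M) : dirDeriv X (fun _ => z) p = 0 := by
  rw [dirDeriv, mvfderiv_const]
  rfl

theorem dirDeriv_clm_comp {E' : Type*} [NormedAddCommGroup E'] [NormedSpace ℝ E'] (X : VField n M)
    (L : E →L[ℝ] E') (hf : MDifferentiableAt (𝓡 (2 * n + 1)) 𝓘(ℝ, E) f p) :
    dirDeriv X (fun q => L (f q)) p = L (dirDeriv X f p) :=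
  congrArg (fun K : TangentSpace (𝓡 (2 * n + 1)) p →L[ℝ] E' => K (X p))
    ((L.hasMFDerivAt (x := f p)).comp p hf.hasMFDerivAt).mfderiv

theorem lieBracket_congr {X' Y' : VField n M} (hU : IsOpen U) (hp : p ∈ U)
    (hX : ∀ q ∈ U, X q = X' q) (hY : ∀ q ∈ U, Y q = Y' q) : 𝓛[X, Y] p = 𝓛[X', Y'] p :=
  Filter.EventuallyEq.mlieBracket_vectorField_eq
    (Filter.eventuallyEq_of_mem (hU.mem_nhds hp) hX)
    (Filter.eventuallyEq_of_mem (hU.mem_nhds hp) hY)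

section Smooth

variable [IsManifold (𝓡 (2 * n + 1)) ∞ M]

theorem SmoothFieldOn.contMDiffAt (hX : SmoothFieldOn X U) (hU : IsOpen U) (hp : p ∈ U) :
    ContMDiffAt (𝓡 (2 * n + 1)) (𝓡 (2 * n + 1)).tangent ∞
      (fun p => (⟨p, X p⟩ : TangentBundle (𝓡 (2 * n + 1)) M)) p :=
  (hX p hp).contMDiffAt (hU.mem_nhds hp)

theorem SmoothFieldOn.mdifferentiableAt (hX : SmoothFieldOn X U) (hU : IsOpen U) (hp : p ∈ U) :
    MDifferentiableAt (𝓡 (2 * n + 1)) (𝓡 (2 * n + 1)).tangent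
      (fun p => (⟨p, X p⟩ : TangentBundle (𝓡 (2 * n + 1)) M)) p :=
  (hX.contMDiffAt hU hp).mdifferentiableAt (by simp)

theorem SmoothFieldOn.mono (hX : SmoothFieldOn X U) (hVU : V ⊆ U) : SmoothFieldOn X V :=
  ContMDiffOn.mono hX hVU

theorem SmoothFieldOn.lieBracket (hU : IsOpen U) (hX : SmoothFieldOn X U)
    (hY : SmoothFieldOn Y U) : SmoothFieldOn 𝓛[X, Y] U := by
  intro p hp
  have : IsManifold (𝓡 (2 * n + 1)) (((⊤ : ℕ∞) : WithTop ℕ∞) + 1) M :=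
    inferInstanceAs (IsManifold (𝓡 (2 * n + 1)) ∞ M)
  have : IsManifold (𝓡 (2 * n + 1)) (minSmoothness ℝ 2) M := by
    rw [minSmoothness_of_isRCLikeNormedField]; infer_instance
  exact (ContMDiffAt.mlieBracket_vectorField (m := ⊤) (n := ⊤) (hX.contMDiffAt hU hp)
    (hY.contMDiffAt hU hp) (by simp)).contMDiffWithinAt

theorem SmoothFieldOn.add (hX : SmoothFieldOn X U) (hY : SmoothFieldOn Y U) :
    SmoothFieldOn (fun p => X p + Y p) U :=
  ContMDiffOn.add_section hX hY

theorem SmoothFieldOn.neg (hX : SmoothFieldOn X U) : SmoothFieldOn (fun p => -X p) U :=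
  ContMDiffOn.neg_section hX

theorem SmoothFieldOn.sub (hX : SmoothFieldOn X U) (hY : SmoothFieldOn Y U) :
    SmoothFieldOn (fun p => X p - Y p) U :=
  ContMDiffOn.sub_section hX hY

theorem SmoothFieldOn.smul {f : M → ℝ} (hf : SmoothFunOn n f U) (hX : SmoothFieldOn X U) :
    SmoothFieldOn (fun p => f p • X p) U :=
  ContMDiffOn.smul_section hf hX

theorem SmoothFieldOn.const_smul (r : ℝ) (hX : SmoothFieldOn X U) :
    SmoothFieldOn (fun p => r • X p) U :=
  hX.smul (smoothFunOn_const r U)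

theorem smoothFieldOn_zero (U : Set M) : SmoothFieldOn (fun _ => 0 : VField n M) U :=
  (Bundle.contMDiff_zeroSection ℝ (TangentSpace (𝓡 (2 * n + 1)) : M → Type)).contMDiffOn

theorem exists_smoothFieldOn_ne_zero (p : M) : ∃ V : Set M, IsOpen V ∧ p ∈ V ∧
    ∃ W : VField n M, SmoothFieldOn W V ∧ W p ≠ 0 := by
  let e := trivializationAt (Model n) (TangentSpace (𝓡 (2 * n + 1)) : M → Type) p
  let b := (EuclideanSpace.basisFun (Fin (2 * n + 1)) ℝ).toBasis
  have hp : p ∈ e.baseSet := FiberBundle.mem_baseSet_trivializationAt' p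
  have : ContMDiffVectorBundle ∞ (Model n) (TangentSpace (𝓡 (2 * n + 1)) : M → Type)
      (𝓡 (2 * n + 1)) := inferInstance
  refine ⟨e.baseSet, e.open_baseSet, hp, e.localFrame b 0,
    Bundle.Trivialization.contMDiffOn_localFrame_baseSet ∞ e b 0, ?_⟩
  rw [Bundle.Trivialization.localFrame_apply_of_mem_baseSet e b hp]
  exact (e.basisAt b hp).ne_zero 0

theorem SmoothFunOn.dirDeriv (hU : IsOpen U) (hf : SmoothFunOn n f U) (hX : SmoothFieldOn X U) :
    SmoothFunOn n (dirDeriv X f) U := by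
  have smooth_tangentMap :=
    ContMDiffOn.contMDiffOn_tangentMapWithin (m := ∞) hf (by simp) hU.uniqueMDiffOn
  refine ((contMDiff_snd_tangentBundle_modelSpace E 𝓘(ℝ, E)).comp_contMDiffOn
    (smooth_tangentMap.comp (t := _) hX fun p hp => hp)).congr fun p hp => ?_
  exact congrArg (fun L : TangentSpace (𝓡 (2 * n + 1)) p →L[ℝ] E => L (X p))
    (mfderivWithin_of_isOpen hU hp).symm

theorem lieBracket_neg_right (hU : IsOpen U) (hp : p ∈ U) (hY : SmoothFieldOn Y U) :
    𝓛[X, fun q => -Y q] p = -𝓛[X, Y] p := by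
  have neg_eq : (fun q => -Y q) = (-1 : ℝ) • Y := by ext q; simp
  rw [neg_eq, VectorField.mlieBracket_const_smul_right (hY.mdifferentiableAt hU hp), neg_one_smul]

theorem lieBracket_add_right (hU : IsOpen U) (hp : p ∈ U) (hY : SmoothFieldOn Y U)
    (hW : SmoothFieldOn W U) : 𝓛[X, fun q => Y q + W q] p = 𝓛[X, Y] p + 𝓛[X, W] p :=
  VectorField.mlieBracket_add_right (hY.mdifferentiableAt hU hp) (hW.mdifferentiableAt hU hp)

theorem lieBracket_smul_right {f : M → ℝ} (hU : IsOpen U) (hp : p ∈ U) (hf : SmoothFunOn n f U)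
    (hY : SmoothFieldOn Y U) :
    𝓛[X, fun q => f q • Y q] p = dirDeriv X f p • Y p + f p • 𝓛[X, Y] p :=
  VectorField.mlieBracket_smul_right (hf.mdifferentiableAt hU hp) (hY.mdifferentiableAt hU hp)

theorem lieBracket_jacobi (hU : IsOpen U) (hp : p ∈ U) (hX : SmoothFieldOn X U)
    (hY : SmoothFieldOn Y U) (hW : SmoothFieldOn W U) :
    𝓛[X, 𝓛[Y, W]] p = 𝓛[𝓛[X, Y], W] p + 𝓛[Y, 𝓛[X, W]] p := by
  have : IsManifold (𝓡 (2 * n + 1)) (minSmoothness ℝ 3) M := by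
    rw [minSmoothness_of_isRCLikeNormedField]; infer_instance
  have two_le : minSmoothness ℝ 2 ≤ ∞ := by
    rw [minSmoothness_of_isRCLikeNormedField]; exact ENat.LEInfty.out
  exact VectorField.leibniz_identity_mlieBracket_apply ((hX.contMDiffAt hU hp).of_le two_le)
    ((hY.contMDiffAt hU hp).of_le two_le) ((hW.contMDiffAt hU hp).of_le two_le)

theorem lieBracket_lieBracket_smul {f : M → ℝ} (hU : IsOpen U) (hp : p ∈ U)
    (hY : SmoothFieldOn Y U) (hW : SmoothFieldOn W U) (hf : SmoothFunOn n f U) :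
    𝓛[X, 𝓛[Y, fun q => f q • W q]] p
      = dirDeriv X (dirDeriv Y f) p • W p + dirDeriv Y f p • 𝓛[X, W] p
        + (dirDeriv X f p • 𝓛[Y, W] p + f p • 𝓛[X, 𝓛[Y, W]] p) := by
  have hYf := hf.dirDeriv hU hY
  have hYW := hY.lieBracket hU hW
  rw [lieBracket_congr hU hp (fun _ _ => rfl) fun q hq => lieBracket_smul_right hU hq hf hW,
    lieBracket_add_right hU hp (hW.smul hYf) (hYW.smul hf), lieBracket_smul_right hU hp hYf hW,
    lieBracket_smul_right hU hp hf hYW]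

-- The Jacobi identity for `X`, `Y` and `f W`, at a point where `W` does not vanish.
theorem dirDeriv_lieBracket_real {f : M → ℝ} (hU : IsOpen U) (hp : p ∈ U)
    (hX : SmoothFieldOn X U) (hY : SmoothFieldOn Y U) (hf : SmoothFunOn n f U) :
    dirDeriv 𝓛[X, Y] f p = dirDeriv X (dirDeriv Y f) p - dirDeriv Y (dirDeriv X f) p := by
  obtain ⟨V, hV, hpV, W, hW, hWp⟩ := exists_smoothFieldOn_ne_zero (n := n) p
  have hUV := hU.inter hV
  have hpUV : p ∈ U ∩ V := ⟨hp, hpV⟩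
  replace hX := hX.mono (V := U ∩ V) Set.inter_subset_left
  replace hY := hY.mono (V := U ∩ V) Set.inter_subset_left
  replace hW := hW.mono (V := U ∩ V) Set.inter_subset_right
  replace hf := hf.mono (V := U ∩ V) Set.inter_subset_left
  have jacobi := lieBracket_jacobi hUV hpUV hX hY (hW.smul hf)
  rw [lieBracket_lieBracket_smul hUV hpUV hY hW hf, lieBracket_lieBracket_smul hUV hpUV hX hW hf,
    lieBracket_smul_right hUV hpUV hf hW, lieBracket_jacobi hUV hpUV hX hY hW] at jacobi
  have smul_eq_zero : (dirDeriv 𝓛[X, Y] f p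
      - (dirDeriv X (dirDeriv Y f) p - dirDeriv Y (dirDeriv X f) p)) • W p = 0 := by
    rw [smul_add, ← sub_eq_zero] at jacobi
    rw [sub_smul, sub_smul, ← neg_eq_zero, ← jacobi]
    abel
  exact sub_eq_zero.1 ((_root_.smul_eq_zero.1 smul_eq_zero).resolve_right hWp)

theorem dirDeriv_lieBracket (hU : IsOpen U) (hp : p ∈ U) (hX : SmoothFieldOn X U)
    (hY : SmoothFieldOn Y U) (hf : SmoothFunOn n f U) :
    dirDeriv 𝓛[X, Y] f p = dirDeriv X (dirDeriv Y f) p - dirDeriv Y (dirDeriv X f) p := by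
  have clm_dirDeriv : ∀ (L : E →L[ℝ] ℝ) {V W : VField n M}, SmoothFieldOn V U →
      dirDeriv W (dirDeriv V fun q => L (f q)) p = L (dirDeriv W (dirDeriv V f) p) := by
    intro L V W hV
    rw [← dirDeriv_clm_comp W L ((hf.dirDeriv hU hV).mdifferentiableAt hU hp)]
    exact dirDeriv_congr W hU
      (fun q hq => dirDeriv_clm_comp V L (hf.mdifferentiableAt hU hq)) hp
  refine (SeparatingDual.eq_iff_forall_dual_eq (R := ℝ)).2 fun L => ?_
  rw [map_sub, ← dirDeriv_clm_comp _ L (hf.mdifferentiableAt hU hp),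
    dirDeriv_lieBracket_real hU hp hX hY (hf.clm_comp L), clm_dirDeriv L hY, clm_dirDeriv L hX]

end Smooth

end RealCalculus

section ComplexFields

variable {n : ℕ} {M : Type u} [TopologicalSpace M] [ChartedSpace (Model n) M]
  {U : Set M} {p : M} {f g : M → ℂ}

theorem conj_complexify (θ : (p : M) → TangentSpace (𝓡 (2 * n + 1)) p →L[ℝ] ℝ) :
    CForm.conj (complexify θ) = complexify θ := by
  funext p
  ext v
  simp [CForm.conj, complexify]

theorem complexify_ap (θ : (p : M) → TangentSpace (𝓡 (2 * n + 1)) p →L[ℝ] ℝ) (Z : CField n M)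
    (p : M) : (complexify θ).ap Z p = ⟨θ p (Z.re p), θ p (Z.im p)⟩ := by
  simp [CForm.ap, complexify, Complex.ext_iff]

theorem dirDeriv_conj (X : VField n M) (f : M → ℂ) (p : M) :
    dirDeriv X (fun q => starRingEnd ℂ (f q)) p = starRingEnd ℂ (dirDeriv X f p) := by
  by_cases hf : MDifferentiableAt (𝓡 (2 * n + 1)) 𝓘(ℝ, ℂ) f p
  · exact dirDeriv_clm_comp X (Complex.conjCLE : ℂ →L[ℝ] ℂ) hf
  · have hf_conj :
        ¬MDifferentiableAt (𝓡 (2 * n + 1)) 𝓘(ℝ, ℂ) (fun q => starRingEnd ℂ (f q)) p := fun h =>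
      hf <| (((Complex.conjCLE : ℂ →L[ℝ] ℂ).mdifferentiableAt).comp p h).congr_of_eventuallyEq
        (Filter.Eventually.of_forall fun q => (Complex.conj_conj (f q)).symm)
    simp only [dirDeriv, mvfderiv, mfderiv_zero_of_not_mdifferentiableAt hf,
      mfderiv_zero_of_not_mdifferentiableAt hf_conj]
    simp

namespace CField

theorem conj_conj (Z : CField n M) : Z.conj.conj = Z := by
  simp [conj]

theorem D_eq (Z : CField n M) (f : M → ℂ) (p : M) :
    Z.D f p = dirDeriv Z.re f p + Complex.I * dirDeriv Z.im f p := rfl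

theorem D_conj (Z : CField n M) (f : M → ℂ) (p : M) :
    Z.conj.D (fun q => starRingEnd ℂ (f q)) p = starRingEnd ℂ (Z.D f p) := by
  have dirDeriv_neg_im : dirDeriv Z.conj.im f p = -dirDeriv Z.im f p :=
    map_neg (mvfderiv (𝓡 (2 * n + 1)) f p) (Z.im p)
  rw [D_eq, D_eq, dirDeriv_conj, dirDeriv_conj, dirDeriv_neg_im, map_neg, map_add, map_mul,
    Complex.conj_I, mul_neg, neg_mul]
  rfl

theorem D_congr (Z : CField n M) (hU : IsOpen U) (hfg : ∀ p ∈ U, f p = g p) (hp : p ∈ U) :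
    Z.D f p = Z.D g p := by
  rw [D_eq, D_eq, dirDeriv_congr _ hU hfg hp, dirDeriv_congr _ hU hfg hp]

theorem D_const (Z : CField n M) (z : ℂ) (p : M) : Z.D (fun _ => z) p = 0 := by
  rw [D_eq, dirDeriv_const, dirDeriv_const, mul_zero, add_zero]

theorem D_const_on (Z : CField n M) {z : ℂ} (hU : IsOpen U) (hf : ∀ p ∈ U, f p = z)
    (hp : p ∈ U) : Z.D f p = 0 := by
  rw [Z.D_congr hU hf hp, D_const]

theorem D_add (Z : CField n M) (hU : IsOpen U) (hf : SmoothFunOn n f U) (hg : SmoothFunOn n g U)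
    (hp : p ∈ U) : Z.D (fun q => f q + g q) p = Z.D f p + Z.D g p := by
  simp only [D_eq, dirDeriv_add _ (hf.mdifferentiableAt hU hp) (hg.mdifferentiableAt hU hp)]
  ring

theorem D_mul (Z : CField n M) (hU : IsOpen U) (hf : SmoothFunOn n f U) (hg : SmoothFunOn n g U)
    (hp : p ∈ U) : Z.D (fun q => f q * g q) p = f p * Z.D g p + g p * Z.D f p := by
  simp only [D_eq, dirDeriv_mul _ (hf.mdifferentiableAt hU hp) (hg.mdifferentiableAt hU hp)]
  ring

theorem D_const_mul (Z : CField n M) (z : ℂ) (hU : IsOpen U) (hf : SmoothFunOn n f U)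
    (hp : p ∈ U) : Z.D (fun q => z * f q) p = z * Z.D f p := by
  rw [Z.D_mul hU (smoothFunOn_const z U) hf hp, D_const, mul_zero, add_zero]

end CField

theorem SmoothFunOn.sum {ι : Type*} (s : Finset ι) {f : ι → M → ℂ}
    (hf : ∀ i, SmoothFunOn n (f i) U) : SmoothFunOn n (fun p => ∑ i ∈ s, f i p) U :=
  contMDiffOn_finsetSum fun i _ => hf i

theorem CField.D_sum_const_mul {ι : Type*} (Z : CField n M) (s : Finset ι) (w : ι → ℂ)
    {f : ι → M → ℂ} (hU : IsOpen U) (hf : ∀ i, SmoothFunOn n (f i) U) (hp : p ∈ U) :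
    Z.D (fun q => ∑ i ∈ s, w i * f i q) p = ∑ i ∈ s, w i * Z.D (f i) p := by
  have h_smooth (i : ι) : SmoothFunOn n (fun q => w i * f i q) U :=
    (smoothFunOn_const (w i) U).mul (hf i)
  classical
  induction s using Finset.induction_on with
  | empty => simpa using Z.D_const 0 p
  | insert i s hi ih =>
    simp only [Finset.sum_insert hi]
    rw [Z.D_add hU (h_smooth i) (SmoothFunOn.sum s h_smooth) hp, Z.D_const_mul (w i) hU (hf i) hp,
      ih]

namespace CForm

theorem conj_conj (φ : CForm n M) : φ.conj.conj = φ := by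
  funext p
  ext v
  simp [conj]

theorem conj_ap_conj (φ : CForm n M) (Z : CField n M) (p : M) :
    φ.conj.ap Z.conj p = starRingEnd ℂ (φ.ap Z p) := by
  simp [ap, conj, CField.conj]

theorem ap_ofReal (φ : CForm n M) (X : VField n M) (p : M) :
    φ.ap (CField.ofReal X) p = φ p (X p) := by
  simp [ap, CField.ofReal]

theorem ap_re (φ : CForm n M) (Z : CField n M) (p : M) :
    φ p (Z.re p) = (φ.ap Z p + φ.ap Z.conj p) / 2 := by
  simp only [ap, CField.conj, map_neg]
  ring

theorem ap_bracket_swap (φ : CForm n M) (Z W : CField n M) (p : M) :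
    φ.ap (Z.bracket W) p = -φ.ap (W.bracket Z) p := by
  simp only [ap, CField.bracket]
  rw [VectorField.mlieBracket_swap_apply (V := Z.re) (W := W.re),
    VectorField.mlieBracket_swap_apply (V := Z.re) (W := W.im),
    VectorField.mlieBracket_swap_apply (V := Z.im) (W := W.re),
    VectorField.mlieBracket_swap_apply (V := Z.im) (W := W.im)]
  simp only [map_sub, map_add, map_neg]
  ring

theorem ap_ofReal_bracket (φ : CForm n M) (X : VField n M) (Z : CField n M) (p : M) :
    φ.ap ((CField.ofReal X).bracket Z) p
      = φ p (VectorField.mlieBracket (𝓡 (2 * n + 1)) X Z.re p)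
        + Complex.I * φ p (VectorField.mlieBracket (𝓡 (2 * n + 1)) X Z.im p) := by
  have zero_bracket (Y : VField n M) :
      VectorField.mlieBracket (𝓡 (2 * n + 1)) (fun _ => 0) Y p = 0 :=
    congrFun VectorField.mlieBracket_zero_left p
  simp only [ap, CField.bracket, CField.ofReal, zero_bracket, sub_zero, add_zero]

theorem ap_ofReal_bracket_ofReal (φ : CForm n M) (X Y : VField n M) (p : M) :
    φ.ap ((CField.ofReal X).bracket (CField.ofReal Y)) p
      = φ p (VectorField.mlieBracket (𝓡 (2 * n + 1)) X Y p) := by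
  have bracket_zero : VectorField.mlieBracket (𝓡 (2 * n + 1)) X (fun _ => 0) p = 0 :=
    congrFun VectorField.mlieBracket_zero_right p
  rw [ap_ofReal_bracket]
  simp only [CField.ofReal, bracket_zero, map_zero, mul_zero, add_zero]

theorem extd_of_ap_const (φ : CForm n M) {Z W : CField n M} {z w : ℂ} (hU : IsOpen U)
    (hZ : ∀ q ∈ U, φ.ap Z q = z) (hW : ∀ q ∈ U, φ.ap W q = w) (hp : p ∈ U) :
    φ.extd Z W p = -φ.ap (Z.bracket W) p := by
  rw [extd, Z.D_const_on hU hW hp, W.D_const_on hU hZ hp, sub_zero, zero_sub]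

end CForm

/-- The combination `∑ a, w a • e a` of complex fields with constant complex coefficients. -/
def CField.linearCombination {ι : Type*} [Fintype ι] (w : ι → ℂ) (e : ι → CField n M) :
    CField n M where
  re p := ∑ a, ((w a).re • (e a).re p - (w a).im • (e a).im p)
  im p := ∑ a, ((w a).re • (e a).im p + (w a).im • (e a).re p)

section LinearCombination

variable {ι : Type*} [Fintype ι]

theorem CForm.ap_linearCombination (φ : CForm n M) (w : ι → ℂ) (e : ι → CField n M) (p : M) :
    φ.ap (CField.linearCombination w e) p = ∑ a, w a * φ.ap (e a) p := by
  simp only [ap, CField.linearCombination, map_sum, Finset.mul_sum, ← Finset.sum_add_distrib,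
    map_add, map_sub, map_smul, Complex.real_smul]
  refine Finset.sum_congr rfl fun a _ => ?_
  conv_rhs => rw [← Complex.re_add_im (w a)]
  linear_combination -((w a).im * φ p ((e a).im p)) * Complex.I_sq

theorem CField.D_linearCombination (w : ι → ℂ) (e : ι → CField n M) (f : M → ℂ) (p : M) :
    (linearCombination w e).D f p = ∑ a, w a * (e a).D f p :=
  CForm.ap_linearCombination (fun p => mvfderiv (𝓡 (2 * n + 1)) f p) w e p

theorem CField.conj_linearCombination (w : ι → ℂ) (e : ι → CField n M) :
    (linearCombination w e).conj
      = linearCombination (fun a => starRingEnd ℂ (w a)) fun a => (e a).conj := by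
  simp [linearCombination, conj, ← Finset.sum_neg_distrib, add_comm]

end LinearCombination

section Smooth

variable [IsManifold (𝓡 (2 * n + 1)) ∞ M]

theorem SmoothFunOn.D {Z : CField n M} (hU : IsOpen U) (hf : SmoothFunOn n f U)
    (hZ : Z.SmoothOn U) : SmoothFunOn n (Z.D f) U :=
  (hf.dirDeriv hU hZ.1).add ((smoothFunOn_const Complex.I U).mul (hf.dirDeriv hU hZ.2))

namespace CField

variable {Z W : CField n M}

theorem SmoothOn.mono {V : Set M} (hZ : Z.SmoothOn U) (hVU : V ⊆ U) : Z.SmoothOn V :=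
  ⟨hZ.1.mono hVU, hZ.2.mono hVU⟩

theorem SmoothOn.conj (hZ : Z.SmoothOn U) : Z.conj.SmoothOn U :=
  ⟨hZ.1, hZ.2.neg⟩

theorem SmoothOn.ofReal {X : VField n M} (hX : SmoothFieldOn X U) : (ofReal X).SmoothOn U :=
  ⟨hX, smoothFieldOn_zero U⟩

theorem SmoothOn.bracket (hU : IsOpen U) (hZ : Z.SmoothOn U) (hW : W.SmoothOn U) :
    (Z.bracket W).SmoothOn U :=
  ⟨(hZ.1.lieBracket hU hW.1).sub (hZ.2.lieBracket hU hW.2),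
    (hZ.1.lieBracket hU hW.2).add (hZ.2.lieBracket hU hW.1)⟩

theorem SmoothOn.linearCombination {ι : Type*} [Fintype ι] (w : ι → ℂ) {e : ι → CField n M}
    (he : ∀ a, (e a).SmoothOn U) : (linearCombination w e).SmoothOn U :=
  ⟨ContMDiffOn.sum_section fun a _ => ((he a).1.const_smul _).sub ((he a).2.const_smul _),
    ContMDiffOn.sum_section fun a _ => ((he a).2.const_smul _).add ((he a).1.const_smul _)⟩

theorem D_bracket (hU : IsOpen U) (hp : p ∈ U) (hZ : Z.SmoothOn U) (hW : W.SmoothOn U)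
    (hf : SmoothFunOn n f U) : (Z.bracket W).D f p = Z.D (W.D f) p - W.D (Z.D f) p := by
  have dirDeriv_D (X : VField n M) {V : CField n M} (hV : V.SmoothOn U) :
      dirDeriv X (V.D f) p
        = dirDeriv X (dirDeriv V.re f) p + Complex.I * dirDeriv X (dirDeriv V.im f) p := by
    have hI := smoothFunOn_const (n := n) Complex.I U
    have h_im := hf.dirDeriv hU hV.2
    have expand := dirDeriv_add X ((hf.dirDeriv hU hV.1).mdifferentiableAt hU hp)
      ((hI.mul h_im).mdifferentiableAt hU hp)
    rwa [dirDeriv_mul X (hI.mdifferentiableAt hU hp) (h_im.mdifferentiableAt hU hp),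
      dirDeriv_const, mul_zero, add_zero] at expand
  have D_bracket_expand : (Z.bracket W).D f p
      = dirDeriv (VectorField.mlieBracket (𝓡 (2 * n + 1)) Z.re W.re) f p
        - dirDeriv (VectorField.mlieBracket (𝓡 (2 * n + 1)) Z.im W.im) f p
        + Complex.I * (dirDeriv (VectorField.mlieBracket (𝓡 (2 * n + 1)) Z.re W.im) f p
          + dirDeriv (VectorField.mlieBracket (𝓡 (2 * n + 1)) Z.im W.re) f p) := by
    simp only [D_eq, dirDeriv, CField.bracket, map_sub, map_add]
  rw [D_bracket_expand, dirDeriv_lieBracket hU hp hZ.1 hW.1 hf,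
    dirDeriv_lieBracket hU hp hZ.2 hW.2 hf, dirDeriv_lieBracket hU hp hZ.1 hW.2 hf,
    dirDeriv_lieBracket hU hp hZ.2 hW.1 hf, D_eq Z, D_eq W, dirDeriv_D _ hZ, dirDeriv_D _ hZ,
    dirDeriv_D _ hW, dirDeriv_D _ hW]
  linear_combination (dirDeriv W.im (dirDeriv Z.im f) p - dirDeriv Z.im (dirDeriv W.im f) p)
    * Complex.I_sq

end CField

namespace CForm

variable {Z W : CField n M}

/-- Every covector is the differential of a function, linear in a chart. So identities between
vectors at `p`, such as those for brackets, may be checked on local functions. -/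
theorem exists_ap_eq_D (φ : CForm n M) (hU : IsOpen U) (hp : p ∈ U) :
    ∃ V ⊆ U, IsOpen V ∧ p ∈ V ∧ ∃ f : M → ℂ, SmoothFunOn n f V ∧
      ∀ Z : CField n M, φ.ap Z p = Z.D f p := by
  obtain ⟨chartDeriv, h_chartDeriv⟩ :=
    isInvertible_mfderiv_extChartAt (I := 𝓡 (2 * n + 1)) (mem_extChartAt_source p)
  let L : Model n →L[ℝ] ℂ := ((φ p).comp chartDeriv.symm.toContinuousLinearMap :)
  have chart_smooth : SmoothFunOn n (extChartAt (𝓡 (2 * n + 1)) p) (chartAt (Model n) p).source :=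
    contMDiffOn_extChartAt
  have hp_source := mem_chart_source (Model n) p
  refine ⟨U ∩ (chartAt (Model n) p).source, Set.inter_subset_left,
    hU.inter (chartAt (Model n) p).open_source, ⟨hp, hp_source⟩,
    fun q => L (extChartAt (𝓡 (2 * n + 1)) p q),
    (chart_smooth.clm_comp L).mono Set.inter_subset_right, fun Z => ?_⟩
  have dirDeriv_eq (X : VField n M) :
      dirDeriv X (fun q => L (extChartAt (𝓡 (2 * n + 1)) p q)) p = φ p (X p) := by
    rw [dirDeriv_clm_comp X L
      (chart_smooth.mdifferentiableAt (chartAt (Model n) p).open_source hp_source)]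
    change φ p (chartDeriv.symm (mfderiv (𝓡 (2 * n + 1)) _ _ p (X p))) = φ p (X p)
    rw [← h_chartDeriv]
    exact congrArg _ (chartDeriv.symm_apply_apply (X p))
  rw [CField.D_eq, dirDeriv_eq, dirDeriv_eq, ap]

theorem ap_bracket_conj (φ : CForm n M) (hU : IsOpen U) (hp : p ∈ U) (hZ : Z.SmoothOn U)
    (hW : W.SmoothOn U) :
    φ.conj.ap (Z.conj.bracket W.conj) p = starRingEnd ℂ (φ.ap (Z.bracket W) p) := by
  obtain ⟨V, hVU, hV, hpV, f, hf, ap_eq_D⟩ := φ.exists_ap_eq_D hU hp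
  have conj_ap_eq_D (Y : CField n M) :
      φ.conj.ap Y p = Y.D (fun q => starRingEnd ℂ (f q)) p := by
    rw [← Y.conj_conj, conj_ap_conj, CField.D_conj, ap_eq_D]
  have D_D_conj (Y Y' : CField n M) :
      Y.conj.D (Y'.conj.D fun q => starRingEnd ℂ (f q)) p = starRingEnd ℂ (Y.D (Y'.D f) p) := by
    rw [funext fun q => Y'.D_conj f q, Y.D_conj]
  rw [conj_ap_eq_D, ap_eq_D, CField.D_bracket hV hpV (hZ.mono hVU).conj (hW.mono hVU).conj hf.conj,
    CField.D_bracket hV hpV (hZ.mono hVU) (hW.mono hVU) hf, D_D_conj, D_D_conj, map_sub]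

theorem ap_bracket_linearCombination {ι κ : Type*} [Fintype ι] [Fintype κ] (φ : CForm n M)
    {e : ι → CField n M} {e' : κ → CField n M} (v : ι → ℂ) (w : κ → ℂ) (hU : IsOpen U)
    (hp : p ∈ U) (he : ∀ a, (e a).SmoothOn U) (he' : ∀ b, (e' b).SmoothOn U) :
    φ.ap ((CField.linearCombination v e).bracket (CField.linearCombination w e')) p
      = ∑ a, ∑ b, v a * w b * φ.ap ((e a).bracket (e' b)) p := by
  obtain ⟨V, hVU, hV, hpV, f, hf, ap_eq_D⟩ := φ.exists_ap_eq_D hU hp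
  replace he (a : ι) := (he a).mono hVU
  replace he' (b : κ) := (he' b).mono hVU
  have D_D_left : (CField.linearCombination v e).D ((CField.linearCombination w e').D f) p
      = ∑ a, ∑ b, v a * w b * (e a).D ((e' b).D f) p := by
    rw [funext (CField.D_linearCombination w e' f), CField.D_linearCombination]
    simp only [CField.D_sum_const_mul _ _ _ hV (fun b => hf.D hV (he' b)) hpV, Finset.mul_sum,
      mul_assoc]
  have D_D_right : (CField.linearCombination w e').D ((CField.linearCombination v e).D f) p
      = ∑ a, ∑ b, v a * w b * (e' b).D ((e a).D f) p := by
    rw [funext (CField.D_linearCombination v e f), CField.D_linearCombination]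
    simp only [CField.D_sum_const_mul _ _ _ hV (fun a => hf.D hV (he a)) hpV, Finset.mul_sum]
    rw [Finset.sum_comm]
    simp only [mul_left_comm, mul_assoc]
  rw [ap_eq_D, CField.D_bracket hV hpV (.linearCombination v he) (.linearCombination w he') hf,
    D_D_left, D_D_right, ← Finset.sum_sub_distrib]
  refine Finset.sum_congr rfl fun a _ => ?_
  rw [← Finset.sum_sub_distrib]
  refine Finset.sum_congr rfl fun b _ => ?_
  rw [ap_eq_D, CField.D_bracket hV hpV (he a) (he' b) hf, mul_sub]

end CForm

end Smooth

end ComplexFields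

section SmoothFunctions

variable {n : ℕ} {M : Type u} [TopologicalSpace M] [ChartedSpace (Model n) M] {U : Set M}

/-- The algebra of smooth complex-valued functions on `U`. -/
def smoothFunctions (n : ℕ) {M : Type u} [TopologicalSpace M] [ChartedSpace (Model n) M]
    (U : Set M) : StarSubalgebra ℂ (U → ℂ) where
  carrier := {g | ∃ f : M → ℂ, SmoothFunOn n f U ∧ ∀ p : U, g p = f p}
  mul_mem' := by
    rintro _ _ ⟨f, hf, eq_f⟩ ⟨g, hg, eq_g⟩
    exact ⟨_, hf.mul hg, fun p => by simp [eq_f, eq_g]⟩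
  add_mem' := by
    rintro _ _ ⟨f, hf, eq_f⟩ ⟨g, hg, eq_g⟩
    exact ⟨_, hf.add hg, fun p => by simp [eq_f, eq_g]⟩
  algebraMap_mem' z := ⟨_, smoothFunOn_const z U, fun _ => rfl⟩
  star_mem' := by
    rintro _ ⟨f, hf, eq_f⟩
    exact ⟨_, hf.conj, fun p => by simp [eq_f]⟩

namespace smoothFunctions

/-- Evaluation at a point of `U`. -/
def eval (p : U) : smoothFunctions n U →⋆ₐ[ℂ] ℂ :=
  (Pi.evalStarAlgHom ℂ (fun _ : U => ℂ) p).comp (smoothFunctions n U).subtype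

theorem eval_ext {a b : smoothFunctions n U} (h : ∀ p, eval p a = eval p b) : a = b :=
  Subtype.ext (funext h)

/-- The restriction to `U` of a function on `M` that is smooth on `U`. -/
def restrict (f : M → ℂ) (hf : SmoothFunOn n f U) : smoothFunctions n U :=
  ⟨fun p => f p, f, hf, fun _ => rfl⟩

@[simp] theorem eval_restrict (f : M → ℂ) (hf : SmoothFunOn n f U) (p : U) :
    eval p (restrict f hf) = f p := rfl

theorem exists_eq_restrict (g : smoothFunctions n U) :
    ∃ f, ∃ hf : SmoothFunOn n f U, g = restrict f hf := by
  obtain ⟨g, f, hf, eq_f⟩ := g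
  exact ⟨f, hf, Subtype.ext (funext eq_f)⟩

theorem smoothFunOn_of_eval (g : smoothFunctions n U) {f : M → ℂ}
    (h : ∀ p : U, eval p g = f p) : SmoothFunOn n f U := by
  obtain ⟨g, hg, rfl⟩ := exists_eq_restrict g
  exact hg.congr fun p hp => (h ⟨p, hp⟩).symm

/-- An extension of `g` to `M`, with arbitrary values outside `U`. -/
def extension (g : smoothFunctions n U) : M → ℂ := (exists_eq_restrict g).choose

theorem extension_smooth (g : smoothFunctions n U) : SmoothFunOn n (extension g) U :=
  (exists_eq_restrict g).choose_spec.choose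

theorem restrict_extension (g : smoothFunctions n U) :
    restrict (extension g) (extension_smooth g) = g :=
  (exists_eq_restrict g).choose_spec.choose_spec.symm

theorem eval_eq_extension (g : smoothFunctions n U) (p : U) : eval p g = extension g p := by
  conv_lhs => rw [← restrict_extension g, eval_restrict]

end smoothFunctions

theorem SmoothFunOn.matrix_inv {ι : Type*} [Fintype ι] [DecidableEq ι] {P : ι → ι → M → ℂ}
    (hP : ∀ a b, SmoothFunOn n (P a b) U)
    (h_det : ∀ p ∈ U, IsUnit (Matrix.of fun a b => P a b p).det) (a b : ι) :
    SmoothFunOn n (fun p => (Matrix.of fun a b => P a b p)⁻¹ a b) U := by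
  let Q : Matrix ι ι (smoothFunctions n U) :=
    Matrix.of fun a b => smoothFunctions.restrict _ (hP a b)
  let eval (p : U) : smoothFunctions n U →+* ℂ := (smoothFunctions.eval (n := n) p).toAlgHom
  have det_smooth : SmoothFunOn n (fun p => (Matrix.of fun a b => P a b p).det) U :=
    smoothFunctions.smoothFunOn_of_eval Q.det fun p => (eval p).map_det Q
  have adjugate_smooth : SmoothFunOn n (fun p => (Matrix.of fun a b => P a b p).adjugate a b) U :=
    smoothFunctions.smoothFunOn_of_eval (Q.adjugate a b) fun p =>
      congrFun₂ ((eval p).map_adjugate Q) a b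
  refine ((det_smooth.inv fun p hp => (h_det p hp).ne_zero).mul adjugate_smooth).congr
    fun p _ => ?_
  rw [Matrix.inv_def, Ring.inverse_eq_inv', Matrix.smul_apply, smul_eq_mul]

namespace smoothFunctions

variable [IsManifold (𝓡 (2 * n + 1)) ∞ M]

/-- A smooth complex vector field as a derivation of the smooth functions. -/
def derivation (hU : IsOpen U) (Z : CField n M) (hZ : Z.SmoothOn U) :
    Derivation ℂ (smoothFunctions n U) (smoothFunctions n U) :=
  Derivation.mk'
    { toFun g := restrict (Z.D (extension g)) ((extension_smooth g).D hU hZ)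
      map_add' a b := eval_ext fun p => by
        rw [map_add, eval_restrict, eval_restrict, eval_restrict,
          ← Z.D_add hU (extension_smooth a) (extension_smooth b) p.2]
        exact Z.D_congr hU (fun q hq => by
          simp only [← eval_eq_extension _ ⟨q, hq⟩, map_add]) p.2
      map_smul' w a := eval_ext fun p => by
        rw [RingHom.id_apply, map_smul, eval_restrict, eval_restrict, smul_eq_mul,
          ← Z.D_const_mul w hU (extension_smooth a) p.2]
        exact Z.D_congr hU (fun q hq => by
          simp only [← eval_eq_extension _ ⟨q, hq⟩, map_smul, smul_eq_mul]) p.2 }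
    fun a b => eval_ext fun p => by
      change Z.D (extension (a * b)) p
        = eval p a * Z.D (extension b) p + eval p b * Z.D (extension a) p
      rw [eval_eq_extension, eval_eq_extension,
        ← Z.D_mul hU (extension_smooth a) (extension_smooth b) p.2]
      exact Z.D_congr hU (fun q hq => by
        simp only [← eval_eq_extension _ ⟨q, hq⟩, map_mul]) p.2

theorem eval_derivation (hU : IsOpen U) (Z : CField n M) (hZ : Z.SmoothOn U)
    (g : smoothFunctions n U) {f : M → ℂ} (h : ∀ p : U, eval p g = f p) (p : U) :
    eval p (derivation hU Z hZ g) = Z.D f p :=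
  Z.D_congr hU (fun q hq => by rw [← h ⟨q, hq⟩, eval_eq_extension]) p.2

end smoothFunctions

end SmoothFunctions

section Pseudohermitian

variable {n : ℕ} {M : Type u} [TopologicalSpace M] [ChartedSpace (Model n) M]
  [IsManifold (𝓡 (2 * n + 1)) ∞ M] {S : Pseudohermitian n M} {U V : Set M} {p : M}

section IsOneZeroOn

variable {Z : CField n M}

theorem IsOneZeroOn.θ_im (hZ : IsOneZeroOn S.θ S.J Z U) (hp : p ∈ U) : S.θ p (Z.im p) = 0 := by
  rw [(hZ p hp).2, map_neg, S.J_mem p _ (hZ p hp).1, neg_zero]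

theorem IsOneZeroOn.complexify_ap (hZ : IsOneZeroOn S.θ S.J Z U) (hp : p ∈ U) :
    (complexify S.θ).ap Z p = 0 := by
  rw [CRGeometry.complexify_ap, (hZ p hp).1, hZ.θ_im hp]
  rfl

theorem IsOneZeroOn.J_re (hZ : IsOneZeroOn S.θ S.J Z U) (hp : p ∈ U) :
    S.J p (Z.re p) = -Z.im p := by
  rw [(hZ p hp).2, neg_neg]

theorem IsOneZeroOn.J_im (hZ : IsOneZeroOn S.θ S.J Z U) (hp : p ∈ U) :
    S.J p (Z.im p) = Z.re p := by
  rw [(hZ p hp).2, map_neg, S.J_sq p _ (hZ p hp).1, neg_neg]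

theorem IsOneZeroOn.linearCombination {ι : Type*} [Fintype ι] {e : ι → CField n M} (w : ι → ℂ)
    (he : ∀ a, IsOneZeroOn S.θ S.J (e a) U) :
    IsOneZeroOn S.θ S.J (CField.linearCombination w e) U := fun p hp => by
  constructor
  · simp [CField.linearCombination, ((he _) p hp).1, (he _).θ_im hp]
  · simp only [CField.linearCombination, map_sum, map_sub, map_smul, (he _).J_re hp,
      (he _).J_im hp, ← Finset.sum_neg_distrib, smul_neg, neg_sub, sub_neg_eq_add, add_comm]

end IsOneZeroOn

namespace AdmissibleFrame

open FrameIndex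

variable (F : AdmissibleFrame S U)

/-- The fields `T, Z_α, Z_{ᾱ}` of the frame. -/
def field : FrameIndex (Fin n) → CField n M := Sum.elim (fun _ => F.T) (Sum.elim F.Z F.Zbar)

/-- The forms `θ, θ^α, θ^{ᾱ}` of the coframe. -/
def coform : FrameIndex (Fin n) → CForm n M :=
  Sum.elim (fun _ => complexify S.θ) (Sum.elim F.ϑ fun a => CForm.conj (F.ϑ a))

/-- The structure functions `θ^k([E_i, E_j])` of the frame. -/
def structFun (i j k : FrameIndex (Fin n)) (p : M) : ℂ :=
  (F.coform k).ap ((F.field i).bracket (F.field j)) p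

theorem field_bar (i : FrameIndex (Fin n)) : F.field (bar i) = (F.field i).conj := by
  rcases i with ⟨⟨⟩⟩ | a | a
  · simp [field, T, CField.conj, CField.ofReal]
  · rfl
  · exact (CField.conj_conj _).symm

theorem coform_bar (i : FrameIndex (Fin n)) : F.coform (bar i) = CForm.conj (F.coform i) := by
  rcases i with ⟨⟨⟩⟩ | a | a
  · exact (conj_complexify S.θ).symm
  · rfl
  · exact (CForm.conj_conj _).symm

theorem field_smooth (i : FrameIndex (Fin n)) : (F.field i).SmoothOn U := by
  rcases i with ⟨⟨⟩⟩ | a | a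
  · exact .ofReal F.reeb_smooth
  · exact F.Z_smooth a
  · exact (F.Z_smooth a).conj

theorem coform_ap_smooth (i : FrameIndex (Fin n)) {Z : CField n M} (hZ : Z.SmoothOn U) :
    SmoothFunOn n ((F.coform i).ap Z) U := by
  have coform_smooth (X : VField n M) (hX : SmoothFieldOn X U) :
      SmoothFunOn n (fun p => F.coform i p (X p)) U := by
    rcases i with ⟨⟨⟩⟩ | a | a
    · have θ_smooth : SmoothFunOn n (fun p => S.θ p (X p)) U := S.θ_smooth U F.isOpen X hX
      exact θ_smooth.clm_comp Complex.ofRealCLM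
    · exact F.ϑ_smooth a U F.isOpen subset_rfl X hX
    · have ϑ_smooth : SmoothFunOn n (fun p => F.ϑ a p (X p)) U :=
        F.ϑ_smooth a U F.isOpen subset_rfl X hX
      exact ϑ_smooth.conj
  exact (coform_smooth _ hZ.1).add ((smoothFunOn_const Complex.I U).mul (coform_smooth _ hZ.2))

theorem structFun_smooth (i j k : FrameIndex (Fin n)) : SmoothFunOn n (F.structFun i j k) U :=
  F.coform_ap_smooth k ((F.field_smooth i).bracket F.isOpen (F.field_smooth j))

theorem coform_ap_field (i j : FrameIndex (Fin n)) (hp : p ∈ U) :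
    (F.coform i).ap (F.field j) p = if i = j then 1 else 0 := by
  have coform_z_ap (a : Fin n) (j : FrameIndex (Fin n)) :
      (F.coform (z a)).ap (F.field j) p = if z a = j then 1 else 0 := by
    rcases j with ⟨⟨⟩⟩ | b | b
    · exact (CForm.ap_ofReal _ _ _).trans (F.ϑ_reeb a p hp)
    · exact (F.ϑ_Z a b p hp).trans (by simp)
    · exact F.ϑ_conj_Z a b p hp
  have θ_ap_Z (b : Fin n) : (complexify S.θ).ap (F.Z b) p = 0 := (F.Z_oneZero b).complexify_ap hp
  rcases i with ⟨⟨⟩⟩ | a | a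
  · rcases j with ⟨⟨⟩⟩ | b | b
    · rw [if_pos rfl]
      exact (CForm.ap_ofReal _ _ _).trans (by simp [coform, complexify, F.θ_reeb p hp])
    · exact θ_ap_Z b
    · change (complexify S.θ).ap (F.Z b).conj p = 0
      rw [← conj_complexify, CForm.conj_ap_conj, θ_ap_Z, map_zero]
  · exact coform_z_ap a j
  · change (F.coform (bar (z a))).ap (F.field j) p = if bar (z a) = j then 1 else 0
    rw [← bar_bar j, coform_bar, field_bar, CForm.conj_ap_conj, coform_z_ap,
      apply_ite (starRingEnd ℂ), map_one, map_zero]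
    exact if_congr ⟨congrArg bar, fun h => by simpa using congrArg bar h⟩ rfl rfl

theorem ϑ_linearCombination_re (w : Fin n → ℂ) (b : Fin n) (hp : p ∈ U) :
    F.ϑ b p ((CField.linearCombination w F.Z).re p) = w b / 2 := by
  rw [CForm.ap_re, CField.conj_linearCombination, CForm.ap_linearCombination,
    CForm.ap_linearCombination]
  simp [F.ϑ_Z b _ p hp, F.ϑ_conj_Z b _ p hp]

theorem eq_zero_of_coform_eq_zero (hp : p ∈ U) (v : TangentSpace (𝓡 (2 * n + 1)) p)
    (hv : ∀ k, F.coform k p v = 0) : v = 0 := by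
  let Φ : TangentSpace (𝓡 (2 * n + 1)) p →ₗ[ℝ] ℝ × (Fin n → ℂ) :=
    (S.θ p).toLinearMap.prod (LinearMap.pi fun a => (F.ϑ a p).toLinearMap)
  have Φ_surjective : Function.Surjective Φ := by
    rintro ⟨s, w⟩
    refine ⟨s • F.reeb p + (CField.linearCombination (2 * w) F.Z).re p,
      Prod.ext ?_ (funext fun b => ?_)⟩
    · have θ_re := (IsOneZeroOn.linearCombination (2 * w) F.Z_oneZero p hp).1
      simp [Φ, F.θ_reeb p hp, θ_re]
    · simp [Φ, F.ϑ_reeb b p hp, F.ϑ_linearCombination_re _ b hp]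
  have finrank_eq : Module.finrank ℝ (TangentSpace (𝓡 (2 * n + 1)) p)
      = Module.finrank ℝ (ℝ × (Fin n → ℂ)) := by
    have finrank_tangent : Module.finrank ℝ (TangentSpace (𝓡 (2 * n + 1)) p) = 2 * n + 1 :=
      finrank_euclideanSpace_fin
    rw [Module.finrank_prod, Module.finrank_pi_fintype]
    simp only [finrank_tangent, Complex.finrank_real_complex, Module.finrank_self,
      Finset.sum_const, Finset.card_univ, Fintype.card_fin, smul_eq_mul]
    ring
  have : FiniteDimensional ℝ (TangentSpace (𝓡 (2 * n + 1)) p) :=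
    inferInstanceAs (FiniteDimensional ℝ (EuclideanSpace ℝ (Fin (2 * n + 1))))
  refine (LinearMap.injective_iff_surjective_of_finrank_eq_finrank finrank_eq).2 Φ_surjective ?_
  rw [map_zero]
  exact Prod.ext (Complex.ofReal_eq_zero.1 (hv t)) (funext fun a => hv (z a))

theorem ap_eq_zero_of_coform_ap_eq_zero (φ : CForm n M) {W : CField n M} (hp : p ∈ U)
    (hW : ∀ k, (F.coform k).ap W p = 0) : φ.ap W p = 0 := by
  have coform_re (k : FrameIndex (Fin n)) : F.coform k p (W.re p) = 0 := by
    have coform_ap_conj : (F.coform k).ap W.conj p = 0 := by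
      rw [← bar_bar k, coform_bar, CForm.conj_ap_conj, hW, map_zero]
    rw [CForm.ap_re, hW, coform_ap_conj, add_zero, zero_div]
  have coform_im (k : FrameIndex (Fin n)) : F.coform k p (W.im p) = 0 := by
    simpa [CForm.ap, coform_re] using hW k
  rw [CForm.ap, F.eq_zero_of_coform_eq_zero hp _ coform_re,
    F.eq_zero_of_coform_eq_zero hp _ coform_im, map_zero, mul_zero, add_zero]

theorem ap_eq_sum (φ : CForm n M) (W : CField n M) (hp : p ∈ U) :
    φ.ap W p = ∑ k, (F.coform k).ap W p * φ.ap (F.field k) p := by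
  let remainder : CField n M := CField.linearCombination ![1, -1]
    ![W, CField.linearCombination (fun k => (F.coform k).ap W p) F.field]
  have ap_remainder (ψ : CForm n M) : ψ.ap remainder p
      = ψ.ap W p - ∑ k, (F.coform k).ap W p * ψ.ap (F.field k) p := by
    simp [remainder, CForm.ap_linearCombination, sub_eq_add_neg]
  refine sub_eq_zero.1 ((ap_remainder φ).symm.trans ?_)
  exact F.ap_eq_zero_of_coform_ap_eq_zero φ hp fun k => by
    simp [ap_remainder, F.coform_ap_field _ _ hp]

theorem D_eq_sum (f : M → ℂ) (W : CField n M) (hp : p ∈ U) :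
    W.D f p = ∑ k, (F.coform k).ap W p * (F.field k).D f p :=
  F.ap_eq_sum (fun p => mvfderiv (𝓡 (2 * n + 1)) f p) W hp

theorem structFun_swap (i j k : FrameIndex (Fin n)) (p : M) :
    F.structFun i j k p = -F.structFun j i k p :=
  CForm.ap_bracket_swap _ _ _ p

theorem structFun_self (i k : FrameIndex (Fin n)) (p : M) : F.structFun i i k p = 0 :=
  self_eq_neg.1 (F.structFun_swap i i k p)

theorem structFun_bar (i j k : FrameIndex (Fin n)) (hp : p ∈ U) :
    F.structFun (bar i) (bar j) (bar k) p = starRingEnd ℂ (F.structFun i j k p) := by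
  rw [structFun, field_bar, field_bar, coform_bar,
    CForm.ap_bracket_conj _ F.isOpen hp (F.field_smooth i) (F.field_smooth j), structFun]

theorem D_commutator {f : M → ℂ} (hV : IsOpen V) (hVU : V ⊆ U) (hf : SmoothFunOn n f V)
    (i j : FrameIndex (Fin n)) (hp : p ∈ V) :
    (F.field i).D ((F.field j).D f) p - (F.field j).D ((F.field i).D f) p
      = ∑ k, F.structFun i j k p * (F.field k).D f p := by
  rw [← CField.D_bracket hV hp ((F.field_smooth i).mono hVU) ((F.field_smooth j).mono hVU) hf]
  exact F.D_eq_sum f _ (hVU hp)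

theorem extd_field (φ : CForm n M) (i j : FrameIndex (Fin n)) (hp : p ∈ U) :
    φ.extd (F.field i) (F.field j) p
      = (F.field i).D (φ.ap (F.field j)) p - (F.field j).D (φ.ap (F.field i)) p
        - ∑ k, F.structFun i j k p * φ.ap (F.field k) p := by
  rw [CForm.extd, F.ap_eq_sum φ ((F.field i).bracket (F.field j)) hp]
  rfl

/-- The derivation of the smooth functions on `V` along the frame field with index `i`. -/
def derivation (hV : IsOpen V) (hVU : V ⊆ U) (i : FrameIndex (Fin n)) :
    Derivation ℂ (smoothFunctions n V) (smoothFunctions n V) :=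
  smoothFunctions.derivation hV (F.field i) ((F.field_smooth i).mono hVU)

theorem eval_derivation (hV : IsOpen V) (hVU : V ⊆ U) (i : FrameIndex (Fin n))
    {g : smoothFunctions n V} {f : M → ℂ} (h : ∀ q, smoothFunctions.eval q g = f q) (q : V) :
    smoothFunctions.eval q (F.derivation hV hVU i g) = (F.field i).D f q :=
  smoothFunctions.eval_derivation _ _ _ _ h q

/-- The restriction of a structure function of the frame to `V`. -/
def structFunOn (hVU : V ⊆ U) (i j k : FrameIndex (Fin n)) : smoothFunctions n V :=
  smoothFunctions.restrict (F.structFun i j k) ((F.structFun_smooth i j k).mono hVU)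

theorem derivation_commutator (hV : IsOpen V) (hVU : V ⊆ U) (i j : FrameIndex (Fin n))
    (g : smoothFunctions n V) :
    F.derivation hV hVU i (F.derivation hV hVU j g)
        - F.derivation hV hVU j (F.derivation hV hVU i g)
      = ∑ k, F.structFunOn hVU i j k * F.derivation hV hVU k g := by
  obtain ⟨f, hf, rfl⟩ := smoothFunctions.exists_eq_restrict g
  have eval_restrict := smoothFunctions.eval_restrict f hf
  refine smoothFunctions.eval_ext fun q => ?_
  rw [map_sub, F.eval_derivation hV hVU i (F.eval_derivation hV hVU j eval_restrict),
    F.eval_derivation hV hVU j (F.eval_derivation hV hVU i eval_restrict),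
    F.D_commutator hV hVU hf i j q.2]
  simp only [map_sum, map_mul, F.eval_derivation hV hVU _ eval_restrict, structFunOn,
    smoothFunctions.eval_restrict]

theorem structFun_jacobi (i j k l : FrameIndex (Fin n)) (hp : p ∈ U) :
    (F.field i).D (F.structFun j k l) p + (F.field j).D (F.structFun k i l) p
      + (F.field k).D (F.structFun i j l) p
      + ∑ m, (F.structFun j k m p * F.structFun i m l p + F.structFun k i m p * F.structFun j m l p
        + F.structFun i j m p * F.structFun k m l p) = 0 := by
  obtain ⟨V, hVU, hV, hpV, f, hf, ap_eq_D⟩ := (F.coform l).exists_ap_eq_D F.isOpen hp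
  have D_field (m : FrameIndex (Fin n)) : (F.field m).D f p = if l = m then 1 else 0 := by
    rw [← ap_eq_D, F.coform_ap_field l m hp]
  have eval_sum := congrArg (smoothFunctions.eval ⟨p, hpV⟩)
    (sum_jacobiator_mul (F.derivation_commutator hV hVU) i j k (smoothFunctions.restrict f hf))
  simpa only [structFunOn, map_sum, map_mul, map_add, map_zero, F.eval_derivation hV hVU _
    (smoothFunctions.eval_restrict _ _), smoothFunctions.eval_restrict, D_field, mul_ite, mul_one,
    mul_zero, Finset.sum_ite_eq, Finset.mem_univ, if_true] using eval_sum

theorem ϑ_J (a : Fin n) {X : VField n M} (hX : S.θ p (X p) = 0) (hp : p ∈ U) :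
    F.ϑ a p (S.J p (X p)) = Complex.I * F.ϑ a p (X p) := by
  let defect : CForm n M := fun q => (F.ϑ a q).comp (S.J q) - Complex.I • F.ϑ a q
  have defect_ap (W : CField n M) : defect.ap W p
      = F.ϑ a p (S.J p (W.re p)) + Complex.I * F.ϑ a p (S.J p (W.im p))
        - Complex.I * (F.ϑ a).ap W p := by
    change F.ϑ a p (S.J p (W.re p)) - Complex.I * F.ϑ a p (W.re p) + Complex.I
      * (F.ϑ a p (S.J p (W.im p)) - Complex.I * F.ϑ a p (W.im p)) = _
    rw [CForm.ap]
    ring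
  have defect_Z (b : Fin n) : defect.ap (F.Z b) p = 0 := by
    rw [defect_ap, (F.Z_oneZero b).J_re hp, (F.Z_oneZero b).J_im hp, CForm.ap, map_neg]
    linear_combination -F.ϑ a p ((F.Z b).im p) * Complex.I_sq
  have defect_Zbar (b : Fin n) : defect.ap (F.Zbar b) p = 0 := by
    have ϑ_conj_Z := F.ϑ_conj_Z a b p hp
    rw [defect_ap, Zbar, ϑ_conj_Z]
    simp only [CForm.ap, CField.conj, map_neg, (F.Z_oneZero b).J_re hp,
      (F.Z_oneZero b).J_im hp] at ϑ_conj_Z ⊢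
    linear_combination -Complex.I * ϑ_conj_Z - F.ϑ a p ((F.Z b).im p) * Complex.I_sq
  have defect_X : defect.ap (CField.ofReal X) p = 0 := by
    rw [F.ap_eq_sum defect _ hp, sum_eq]
    have θ_X : (F.coform t).ap (CField.ofReal X) p = 0 :=
      (CForm.ap_ofReal _ _ _).trans (congrArg Complex.ofReal hX)
    simp only [θ_X, zero_mul, zero_add]
    simp [field, defect_Z, defect_Zbar]
  exact sub_eq_zero.1 ((CForm.ap_ofReal defect X p).symm.trans defect_X)

theorem Z_bracket_Z_oneZero (a b : Fin n) : IsOneZeroOn S.θ S.J ((F.Z a).bracket (F.Z b)) U :=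
  S.integrable U F.isOpen _ _ (F.Z_smooth a) (F.Z_smooth b) (F.Z_oneZero a) (F.Z_oneZero b)

theorem structFun_z_z_t (a b : Fin n) (hp : p ∈ U) : F.structFun (z a) (z b) t p = 0 :=
  (F.Z_bracket_Z_oneZero a b).complexify_ap hp

theorem structFun_z_z_zb (a b d : Fin n) (hp : p ∈ U) :
    F.structFun (z a) (z b) (zb d) p = 0 := by
  have bracket_oneZero := F.Z_bracket_Z_oneZero a b
  have ϑ_im := F.ϑ_J d (bracket_oneZero p hp).1 hp
  rw [bracket_oneZero.J_re hp, map_neg] at ϑ_im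
  have ϑ_bracket_conj : (F.ϑ d).ap ((F.Z a).bracket (F.Z b)).conj p = 0 := by
    rw [CForm.ap]
    simp only [CField.conj, map_neg, ϑ_im]
    linear_combination F.ϑ d p (((F.Z a).bracket (F.Z b)).re p) * Complex.I_sq
  have conj_ap := CForm.conj_ap_conj (F.ϑ d) ((F.Z a).bracket (F.Z b)).conj p
  rwa [CField.conj_conj, ϑ_bracket_conj, map_zero] at conj_ap

theorem θ_lieBracket_reeb {X : VField n M} {s : ℝ} (hX : SmoothFieldOn X U)
    (hs : ∀ q ∈ U, S.θ q (X q) = s) (hp : p ∈ U) :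
    S.θ p (VectorField.mlieBracket (𝓡 (2 * n + 1)) F.reeb X p) = 0 := by
  have contract := F.reeb_contract U F.isOpen subset_rfl X hX p hp
  have θ_ap (Y : VField n M) {r : ℝ} (hr : ∀ q ∈ U, S.θ q (Y q) = r) :
      ∀ q ∈ U, (complexify S.θ).ap (CField.ofReal Y) q = r := fun q hq =>
    (CForm.ap_ofReal _ _ _).trans (congrArg Complex.ofReal (hr q hq))
  rw [CForm.extd_of_ap_const _ F.isOpen (θ_ap _ F.θ_reeb) (θ_ap _ hs) hp,
    CForm.ap_ofReal_bracket_ofReal, neg_eq_zero] at contract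
  exact Complex.ofReal_eq_zero.1 contract

theorem structFun_t_t (i : FrameIndex (Fin n)) (hp : p ∈ U) : F.structFun t i t p = 0 := by
  have θ_field (q : M) (hq : q ∈ U) :
      (⟨S.θ q ((F.field i).re q), S.θ q ((F.field i).im q)⟩ : ℂ) = if t = i then 1 else 0 := by
    rw [← complexify_ap]
    exact F.coform_ap_field t i hq
  have θ_bracket_re := F.θ_lieBracket_reeb (F.field_smooth i).1
    (fun q hq => congrArg Complex.re (θ_field q hq)) hp
  have θ_bracket_im := F.θ_lieBracket_reeb (F.field_smooth i).2
    (fun q hq => congrArg Complex.im (θ_field q hq)) hp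
  refine (CForm.ap_ofReal_bracket (complexify S.θ) F.reeb (F.field i) p).trans ?_
  simp [complexify, θ_bracket_re, θ_bracket_im]

theorem h_eq (a b : Fin n) (hp : p ∈ U) :
    F.h a b p = Complex.I * F.structFun (z a) (zb b) t p := by
  have θ_Z : ∀ q ∈ U, (complexify S.θ).ap (F.Z a) q = 0 := fun _ hq =>
    F.coform_ap_field t (z a) hq
  have θ_Zbar : ∀ q ∈ U, (complexify S.θ).ap (F.Zbar b) q = 0 := fun _ hq =>
    F.coform_ap_field t (zb b) hq
  rw [h, CForm.extd_of_ap_const _ F.isOpen θ_Z θ_Zbar hp, neg_mul_neg]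
  rfl

end AdmissibleFrame

section LeviForm

variable {Z : CField n M}

theorem CForm.ap_bracket_conj_self (φ : CForm n M) (hU : IsOpen U) (hp : p ∈ U)
    (hZ : Z.SmoothOn U) : φ.ap (Z.bracket Z.conj) p
      = -2 * Complex.I * φ p (VectorField.mlieBracket (𝓡 (2 * n + 1)) Z.re Z.im p) := by
  simp only [CForm.ap, CField.bracket, CField.conj]
  rw [lieBracket_neg_right hU hp hZ.2, lieBracket_neg_right hU hp hZ.2,
    VectorField.mlieBracket_swap_apply (V := Z.im) (W := Z.re), VectorField.mlieBracket_self,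
    VectorField.mlieBracket_self]
  simp only [Pi.zero_apply, neg_zero, sub_zero, map_zero, zero_add, map_add, map_neg]
  ring

theorem IsOneZeroOn.θ_lieBracket_pos (hZ : IsOneZeroOn S.θ S.J Z U) (hU : IsOpen U)
    (hZ_smooth : Z.SmoothOn U) (hp : p ∈ U) (re_ne_zero : Z.re p ≠ 0) :
    0 < S.θ p (VectorField.mlieBracket (𝓡 (2 * n + 1)) Z.re Z.im p) := by
  have pseudoconvex :=
    S.pseudoconvex U hU Z.re hZ_smooth.1 (fun q hq => (hZ q hq).1) p hp re_ne_zero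
  have θ_ap {X : VField n M} (hX : ∀ q ∈ U, S.θ q (X q) = 0) :
      ∀ q ∈ U, (complexify S.θ).ap (CField.ofReal X) q = 0 := fun q hq =>
    (CForm.ap_ofReal _ _ _).trans (congrArg Complex.ofReal (hX q hq))
  have θ_J_re (q : M) (hq : q ∈ U) : S.θ q (S.J q (Z.re q)) = 0 := S.J_mem q _ (hZ q hq).1
  rw [CForm.extd_of_ap_const _ hU (θ_ap fun q hq => (hZ q hq).1) (θ_ap θ_J_re) hp,
    CForm.ap_ofReal_bracket_ofReal,
    lieBracket_congr hU hp (fun _ _ => rfl) (fun q hq => hZ.J_re hq),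
    lieBracket_neg_right hU hp hZ_smooth.2] at pseudoconvex
  simpa [complexify] using pseudoconvex

end LeviForm

namespace AdmissibleFrame

open FrameIndex Matrix

variable (F : AdmissibleFrame S U)

theorem dotProduct_h_mulVec_pos {w : Fin n → ℂ} (hw : w ≠ 0) (hp : p ∈ U) :
    0 < (star w ⬝ᵥ (Matrix.of fun a b => F.h a b p) *ᵥ w).re := by
  let Z : CField n M := CField.linearCombination (star w) F.Z
  have hZ : IsOneZeroOn S.θ S.J Z U := .linearCombination _ F.Z_oneZero
  have hZ_smooth : Z.SmoothOn U := .linearCombination _ F.Z_smooth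
  have re_ne_zero : Z.re p ≠ 0 := fun re_eq_zero => hw <| funext fun b => by
    have ϑ_re := F.ϑ_linearCombination_re (star w) b hp
    rw [re_eq_zero, map_zero] at ϑ_re
    simpa using ϑ_re.symm
  have bracket_eq := (complexify S.θ).ap_bracket_conj_self F.isOpen hp hZ_smooth
  rw [CField.conj_linearCombination, CForm.ap_bracket_linearCombination _ _ _ F.isOpen hp
    F.Z_smooth fun b => (F.Z_smooth b).conj] at bracket_eq
  have levi_eq : star w ⬝ᵥ (Matrix.of fun a b => F.h a b p) *ᵥ w
      = (2 * S.θ p (VectorField.mlieBracket (𝓡 (2 * n + 1)) Z.re Z.im p) : ℝ) := by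
    calc star w ⬝ᵥ (Matrix.of fun a b => F.h a b p) *ᵥ w
        = Complex.I * ∑ a, ∑ b, star w a * starRingEnd ℂ (star w b)
            * (complexify S.θ).ap ((F.Z a).bracket (F.Z b).conj) p := by
          simp only [dotProduct, mulVec, Matrix.of_apply, Finset.mul_sum, F.h_eq _ _ hp]
          refine Finset.sum_congr rfl fun a _ => Finset.sum_congr rfl fun b _ => ?_
          rw [Pi.star_apply w b, Complex.star_def, Complex.conj_conj]
          change star w a * (Complex.I * (complexify S.θ).ap ((F.Z a).bracket (F.Z b).conj) p
            * w b) = _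
          ring
      _ = _ := by
          rw [bracket_eq, Complex.ofReal_mul, Complex.ofReal_ofNat]
          change Complex.I * (-2 * Complex.I * Complex.ofReal _) = _
          linear_combination -2 * Complex.ofReal _ * Complex.I_sq
  rw [levi_eq, Complex.ofReal_re]
  exact mul_pos two_pos (hZ.θ_lieBracket_pos F.isOpen hZ_smooth hp re_ne_zero)

theorem isUnit_det_h (hp : p ∈ U) : IsUnit (Matrix.of fun a b => F.h a b p).det := by
  refine isUnit_iff_ne_zero.2 fun det_eq_zero => ?_
  obtain ⟨w, hw, mulVec_eq_zero⟩ := Matrix.exists_mulVec_eq_zero_iff.2 det_eq_zero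
  simpa [mulVec_eq_zero] using F.dotProduct_h_mulVec_pos hw hp

end AdmissibleFrame

namespace AdmissibleFrame

open FrameIndex smoothFunctions

variable (F : AdmissibleFrame S U)

theorem h_smooth (a b : Fin n) : SmoothFunOn n (F.h a b) U :=
  ((smoothFunOn_const Complex.I U).mul (F.structFun_smooth (z a) (zb b) t)).congr
    fun _ hp => F.h_eq a b hp

theorem hInv_smooth (a b : Fin n) : SmoothFunOn n (F.hInv a b) U :=
  SmoothFunOn.matrix_inv F.h_smooth (fun _ hp => F.isUnit_det_h hp) b a

/-- The algebraic model of the frame, over the smooth functions on `U`. -/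
def crFrame : CRFrame (Fin n) (smoothFunctions n U) where
  E := F.derivation F.isOpen subset_rfl
  c := F.structFunOn subset_rfl
  c_self i k := eval_ext fun p => F.structFun_self i k p
  c_swap i j k := eval_ext fun p => F.structFun_swap i j k p
  commutator := F.derivation_commutator F.isOpen subset_rfl
  jacobi i j k l := eval_ext fun p => by
    simp only [structFunOn, map_add, map_sum, map_mul, map_zero, eval_restrict,
      F.eval_derivation F.isOpen subset_rfl _ (eval_restrict _ _)]
    exact F.structFun_jacobi i j k l p.2
  leviInv := Matrix.of fun a b => restrict (F.hInv b a) (F.hInv_smooth b a)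
  E_star i g := by
    obtain ⟨f, hf, rfl⟩ := exists_eq_restrict g
    refine eval_ext fun p => ?_
    rw [map_star (eval p) (F.derivation F.isOpen subset_rfl i (restrict f hf)),
      F.eval_derivation F.isOpen subset_rfl i (eval_restrict f hf), Complex.star_def,
      ← CField.D_conj, ← field_bar]
    exact F.eval_derivation F.isOpen subset_rfl _ (fun _ => rfl) p
  c_star i j k := eval_ext fun p => F.structFun_bar i j k p.2
  c_z_z_t a b := eval_ext fun p => F.structFun_z_z_t a b p.2
  c_z_z_zb a b d := eval_ext fun p => F.structFun_z_z_zb a b d p.2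
  c_t_t i := eval_ext fun p => F.structFun_t_t i p.2
  leviInv_mul := by
    ext1 a b
    refine eval_ext fun p => ?_
    have inv_mul := congrFun₂ (Matrix.nonsing_inv_mul _ (F.isUnit_det_h p.2)) a b
    rw [Matrix.mul_apply, Matrix.one_apply] at inv_mul
    rw [Matrix.mul_apply, Matrix.one_apply, map_sum, apply_ite (eval p), map_one, map_zero,
      ← inv_mul]
    refine Finset.sum_congr rfl fun d _ => ?_
    rw [map_mul, Matrix.of_apply, Matrix.of_apply, F.h_eq d b p.2]
    rfl

section Eval

variable (p : U)

theorem eval_E (i : FrameIndex (Fin n)) {g : smoothFunctions n U} {f : M → ℂ}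
    (h : ∀ q, eval q g = f q) : eval p (F.crFrame.E i g) = (F.field i).D f p :=
  F.eval_derivation F.isOpen subset_rfl i h p

theorem eval_c (i j k : FrameIndex (Fin n)) :
    eval p (F.crFrame.c i j k) = F.structFun i j k p := rfl

theorem eval_leviInv (a b : Fin n) : eval p (F.crFrame.leviInv a b) = F.hInv b a p := rfl

theorem eval_levi (a b : Fin n) : eval p (F.crFrame.levi a b) = F.h a b p := by
  rw [F.h_eq a b p.2]
  exact map_smul (eval p) _ _

theorem eval_torsion (a b : Fin n) : eval p (F.crFrame.torsion a b) = F.A a b p := by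
  simp only [CRFrame.torsion, Matrix.neg_apply, Matrix.conjTranspose_apply, Matrix.mul_apply,
    map_neg, map_star, map_sum, map_mul, eval_levi, A, mul_neg, Finset.sum_neg_distrib,
    Complex.star_def, mul_comm (starRingEnd ℂ (F.h _ _ _))]
  rfl

theorem conj_h (a b : Fin n) : starRingEnd ℂ (F.h a b p) = F.h b a p := by
  rw [← eval_levi, ← eval_levi, ← Complex.star_def, ← map_star (eval p), CRFrame.star_levi]

theorem eval_conn_z (g a b : Fin n) :
    eval p (F.crFrame.conn (z g) a b) = F.connHol g a b p := by
  simp only [CRFrame.conn, Matrix.mul_apply, Matrix.sub_apply, Matrix.map_apply,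
    Matrix.conjTranspose_apply, map_sum, map_mul, map_sub, map_star, eval_leviInv, eval_levi,
    F.eval_E _ _ fun q => F.eval_levi q _ _, connHol, mul_comm (F.hInv _ _ _),
    map_mul, conj_h]
  rfl

theorem conn_ap (a b : Fin n) (W : CField n M) (p : M) : (F.conn a b).ap W p
    = (∑ g, (F.connHol g a b p * (F.coform (z g)).ap W p
        + F.connBar g a b p * (F.coform (zb g)).ap W p))
      + F.connReeb a b p * (F.coform t).ap W p := by
  simp only [coform, CForm.ap, conn, add_apply, sum_apply, smul_apply, smul_eq_mul, mul_add,
    Finset.sum_add_distrib, Finset.mul_sum, Sum.elim_inl, Sum.elim_inr]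
  ring_nf

theorem eval_conn (i : FrameIndex (Fin n)) (a b : Fin n) :
    eval p (F.crFrame.conn i a b) = (F.conn a b).ap (F.field i) p := by
  rw [conn_ap]
  simp only [F.coform_ap_field _ _ p.2]
  rcases i with ⟨⟨⟩⟩ | g | g
  · simp only [reduceCtorEq, ↓reduceIte, mul_zero, add_zero, Finset.sum_const_zero, mul_one,
      zero_add]
    rfl
  · simp [eval_conn_z]
  · simp only [Sum.inr.injEq, reduceCtorEq, ↓reduceIte, mul_zero, mul_ite, mul_one, zero_add,
      Finset.sum_ite_eq', Finset.mem_univ, add_zero]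
    rfl

theorem eval_divTorsion (a : Fin n) : eval p (F.crFrame.divTorsion a) = F.divA a p := by
  simp only [CRFrame.divTorsion, CRFrame.nablaTorsion, Matrix.mul_apply, Matrix.sub_apply,
    Matrix.map_apply, Matrix.transpose_apply, map_sum, map_mul, map_sub, eval_leviInv,
    eval_torsion, eval_conn, F.eval_E _ _ fun q => F.eval_torsion q _ _]
  rw [Finset.sum_comm]
  simp only [divA, nablaBarTwo, mul_comm (F.hInv _ _ _), mul_comm (F.A a _ _)]
  rfl

theorem ricci_eq_sum_extd (a b : Fin n) (p : M) :
    F.ricci a b p = ∑ g, (F.conn g g).extd (F.Z a) (F.Zbar b) p := by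
  have sum_wedge : ∑ g, ∑ d, CForm.wedge (F.conn g d) (F.conn d g) (F.Z a) (F.Zbar b) p = 0 := by
    simp only [CForm.wedge, Finset.sum_sub_distrib]
    rw [sub_eq_zero, Finset.sum_comm]
    simp only [mul_comm]
  simp only [ricci, curv, curvForm, Finset.sum_sub_distrib, sum_wedge, sub_zero]

theorem eval_ricci (a b : Fin n) : eval p (F.crFrame.ricci a b) = F.ricci a b p := by
  have extd_conn (g : Fin n) : (F.conn g g).extd (F.Z a) (F.Zbar b) p
      = eval p (F.crFrame.extd (fun k => F.crFrame.conn k g g) (z a) (zb b)) := by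
    simp only [DerivationFrame.extd, map_sub, map_sum, map_mul, eval_conn, eval_c,
      F.eval_E _ _ fun q => F.eval_conn q _ _ _]
    exact F.extd_field (F.conn g g) (z a) (zb b) p.2
  rw [ricci_eq_sum_extd, CRFrame.ricci, Matrix.of_apply, DerivationFrame.trace_curv]
  simp only [extd_conn, ← map_sum]
  congr 1
  simp only [DerivationFrame.extd, Matrix.trace, Matrix.diag_apply, map_sum,
    Finset.sum_sub_distrib, Finset.mul_sum]
  rw [Finset.sum_comm (s := (Finset.univ : Finset (FrameIndex (Fin n))))]

theorem eval_scal : eval p F.crFrame.scal = F.scal p := by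
  simp only [CRFrame.scal, Matrix.trace, Matrix.diag_apply, Matrix.mul_apply, map_sum, map_mul,
    eval_leviInv, eval_ricci, scal]
  exact Finset.sum_comm

end Eval

theorem scal_smooth : SmoothFunOn n F.scal U := smoothFunOn_of_eval _ F.eval_scal

theorem divA_smooth (a : Fin n) : SmoothFunOn n (F.divA a) U :=
  smoothFunOn_of_eval _ fun p => F.eval_divTorsion p a

theorem conj_scal (hp : p ∈ U) : starRingEnd ℂ (F.scal p) = F.scal p := by
  have star_scal := congrArg (eval ⟨p, hp⟩) F.crFrame.star_scal
  rwa [map_star, eval_scal] at star_scal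

theorem conj_hInv (a b : Fin n) (hp : p ∈ U) :
    starRingEnd ℂ (F.hInv a b p) = F.hInv b a p :=
  congrArg (eval ⟨p, hp⟩) (congrFun₂ F.crFrame.conjTranspose_leviInv a b)

theorem grad_scal (hn : 2 ≤ n) (hS : S.IsPseudoEinstein) (a : Fin n) (hp : p ∈ U) :
    F.grad F.scal a p = Complex.I * n * F.divA a p := by
  have : Nontrivial (Fin n) := Fin.nontrivial_iff_two_le.2 hn
  have ricci_eq : F.crFrame.ricci = ((1 / (n : ℂ)) • F.crFrame.scal) • F.crFrame.levi := by
    ext1 b d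
    refine eval_ext fun q => ?_
    rw [Matrix.smul_apply, smul_eq_mul, map_mul, map_smul, eval_ricci, eval_scal, eval_levi]
    exact sub_eq_zero.1 ((hS U F q q.2).1 hn b d)
  have schur := congrArg (eval ⟨p, hp⟩) (F.crFrame.E_eq_divTorsion_of_ricci_eq ricci_eq a)
  rw [Derivation.map_smul, map_smul (eval _), map_smul (eval _), F.eval_E _ _ F.eval_scal,
    eval_divTorsion] at schur
  have n_ne_zero : (n : ℂ) ≠ 0 := Nat.cast_ne_zero.2 (by omega)
  change 1 / (n : ℂ) * F.grad F.scal a p = Complex.I * F.divA a p at schur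
  field_simp at schur
  linear_combination schur

end AdmissibleFrame

namespace AdmissibleFrame

variable (F : AdmissibleFrame S U)

theorem div_congr {τ σ : Fin n → M → ℂ} (h : ∀ a, ∀ p ∈ U, τ a p = σ a p) (hp : p ∈ U) :
    F.div τ p = F.div σ p := by
  simp only [div, nablaBarForm, CField.D_congr _ F.isOpen (h _) hp, h _ p hp]

theorem div_const_mul (w : ℂ) {τ : Fin n → M → ℂ} (hτ : ∀ a, SmoothFunOn n (τ a) U)
    (hp : p ∈ U) : F.div (fun a q => w * τ a q) p = w * F.div τ p := by
  simp only [div, nablaBarForm, CField.D_const_mul _ w F.isOpen (hτ _) hp, mul_left_comm _ w,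
    ← Finset.mul_sum, ← mul_sub]

theorem divBar_congr {τ σ : Fin n → M → ℂ} (h : ∀ a, ∀ p ∈ U, τ a p = σ a p) (hp : p ∈ U) :
    F.divBar τ p = F.divBar σ p := by
  simp only [divBar, nablaFormBar, CField.D_congr _ F.isOpen (h _) hp, h _ p hp]

theorem divBar_conj (τ : Fin n → M → ℂ) (hp : p ∈ U) :
    F.divBar (fun a q => starRingEnd ℂ (τ a q)) p = starRingEnd ℂ (F.div τ p) := by
  have nabla_conj (b a : Fin n) : F.nablaFormBar (fun a q => starRingEnd ℂ (τ a q)) b a p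
      = starRingEnd ℂ (F.nablaBarForm τ b a p) := by
    simp only [nablaFormBar, nablaBarForm, Zbar, map_sub, map_sum, map_mul, ← CField.D_conj,
      ← CForm.conj_ap_conj, CField.conj_conj]
  simp only [divBar, div, map_sum, map_mul, conj_hInv, hp, nabla_conj]
  exact Finset.sum_comm

theorem gradBar_of_real {f : M → ℂ} (hf : ∀ p ∈ U, starRingEnd ℂ (f p) = f p) (a : Fin n)
    (hp : p ∈ U) : F.gradBar f a p = starRingEnd ℂ (F.grad f a p) := by
  rw [gradBar, grad, ← CField.D_conj, CField.D_congr _ F.isOpen hf hp, Zbar]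

theorem sublaplacian_of_real {f : M → ℂ} (hf : ∀ p ∈ U, starRingEnd ℂ (f p) = f p)
    (hp : p ∈ U) : F.sublaplacian f p = -(2 * ((F.div (F.grad f) p).re : ℂ)) := by
  rw [sublaplacian, F.divBar_congr (fun a q hq => F.gradBar_of_real hf a hq) hp,
    F.divBar_conj _ hp, Complex.add_conj, Complex.ofReal_mul, Complex.ofReal_ofNat]

theorem sublaplacian_const_mul (r : ℝ) {f : M → ℂ} (hf : SmoothFunOn n f U)
    (hf_real : ∀ p ∈ U, starRingEnd ℂ (f p) = f p) (hp : p ∈ U) :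
    F.sublaplacian (fun q => r * f q) p = r * F.sublaplacian f p := by
  have grad_const_mul (a : Fin n) : ∀ q ∈ U, F.grad (fun q => r * f q) a q = r * F.grad f a q :=
    fun q hq => (F.Z a).D_const_mul r F.isOpen hf hq
  have conj_const_mul : ∀ q ∈ U, starRingEnd ℂ (r * f q) = r * f q := fun q hq => by
    rw [map_mul, hf_real q hq, Complex.conj_ofReal]
  rw [F.sublaplacian_of_real conj_const_mul hp, F.sublaplacian_of_real hf_real hp,
    F.div_congr grad_const_mul hp,
    F.div_const_mul r (τ := F.grad f) (fun a => hf.D F.isOpen (F.Z_smooth a)) hp,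
    Complex.re_ofReal_mul, Complex.ofReal_mul]
  ring

theorem sublaplacian_schoutenTrace (hp : p ∈ U) :
    F.sublaplacian F.schoutenTrace p = F.sublaplacian F.scal p / (2 * ((n : ℂ) + 1)) := by
  have schoutenTrace_eq : F.schoutenTrace
      = fun q => (((2 * ((n : ℝ) + 1))⁻¹ : ℝ) : ℂ) * F.scal q := by
    funext q
    rw [schoutenTrace]
    push_cast
    rw [div_eq_inv_mul]
  rw [schoutenTrace_eq, F.sublaplacian_const_mul _ F.scal_smooth (fun q hq => F.conj_scal hq) hp]
  push_cast
  rw [div_eq_inv_mul]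

theorem sublaplacian_scal (hn : 2 ≤ n) (hS : S.IsPseudoEinstein) (hp : p ∈ U) :
    F.sublaplacian F.scal p = 2 * n * F.imDivDivA p := by
  rw [F.sublaplacian_of_real (fun q hq => F.conj_scal hq) hp,
    F.div_congr (fun a q hq => F.grad_scal hn hS a hq) hp, F.div_const_mul _ F.divA_smooth hp,
    imDivDivA]
  simp only [Complex.mul_re, Complex.I_re, Complex.natCast_re, zero_mul, Complex.I_im,
    Complex.natCast_im, mul_zero, sub_self, Complex.mul_im, one_mul, zero_add, zero_sub,
    Complex.ofReal_neg, Complex.ofReal_mul, Complex.ofReal_natCast, mul_neg, neg_neg]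
  ring

theorem schoutenTF_eq_zero (hn : 2 ≤ n) (hS : S.IsPseudoEinstein) (a b : Fin n) (hp : p ∈ U) :
    F.schoutenTF a b p = 0 := by
  have n_ne_zero : (n : ℂ) ≠ 0 := by norm_cast; omega
  have n_add_one_ne_zero : (n : ℂ) + 1 ≠ 0 := by norm_cast
  have n_add_two_ne_zero : (n : ℂ) + 2 ≠ 0 := by norm_cast
  rw [schoutenTF, schouten, schoutenTrace, sub_eq_zero.1 ((hS U F p hp).1 hn a b)]
  field_simp
  ring

theorem normSqSchoutenTF_eq_zero (hn : 2 ≤ n) (hS : S.IsPseudoEinstein) (hp : p ∈ U) :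
    F.normSqSchoutenTF p = 0 := by
  simp only [normSqSchoutenTF, F.schoutenTF_eq_zero hn hS _ _ hp, zero_mul,
    Finset.sum_const_zero]

theorem grad_const (w : ℂ) (a : Fin n) : F.grad (fun _ => w) a = fun _ => 0 :=
  funext fun _ => CField.D_const _ _ _

theorem gradBar_const (w : ℂ) (a : Fin n) : F.gradBar (fun _ => w) a = fun _ => 0 :=
  funext fun _ => CField.D_const _ _ _

theorem nabla0_const (w : ℂ) : F.nabla0 (fun _ => w) = fun _ => 0 :=
  funext fun _ => CField.D_const _ _ _

theorem sublaplacian_const (w : ℂ) : F.sublaplacian (fun _ => w) = fun _ => 0 := by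
  funext q
  simp [sublaplacian, div, divBar, nablaBarForm, nablaFormBar, grad_const, gradBar_const,
    CField.D_const]

theorem P4_one (p : M) : F.P4 (fun _ => 1) p = ((n : ℂ) - 1) / 2 * F.Q4 p := by
  simp [P4, sublaplacian_const, nabla0_const, grad_const, gradBar_const, gradUp, CField.D_const,
    div, divVecBar, nablaBarForm]

theorem P4_one_of_isPseudoEinstein (hn : 2 ≤ n) (hS : S.IsPseudoEinstein) (hp : p ∈ U) :
    4 / ((n : ℂ) - 1) ^ 2 * F.P4 (fun _ => 1) p = 2 / (n : ℂ) ^ 2 * F.sublaplacian F.scal p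
      - 4 / (n : ℂ) * F.normSqA p + 1 / (n : ℂ) ^ 2 * F.scal p ^ 2 := by
  have n_ne_zero : (n : ℂ) ≠ 0 := by norm_cast; omega
  have n_add_one_ne_zero : (n : ℂ) + 1 ≠ 0 := by norm_cast
  have n_add_two_ne_zero : (n : ℂ) + 2 ≠ 0 := by norm_cast
  have n_sub_one_ne_zero : (n : ℂ) - 1 ≠ 0 := sub_ne_zero.2 (by norm_cast; omega)
  rw [P4_one, Q4, F.sublaplacian_schoutenTrace hp, F.normSqSchoutenTF_eq_zero hn hS hp,
    F.sublaplacian_scal hn hS hp, schoutenTrace]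
  field_simp
  ring

end AdmissibleFrame

/-- The expression `2/n² Δ_b R - 4/n |A|² + 1/n² R²` for the `Q'`-curvature, with coefficients
over the common denominator `n²`. -/
def qPrimeExpr : DimExpr where
  num := ![2, 0, -(4 * Polynomial.X), 0, 1]
  den := Polynomial.X ^ 2

theorem qPrimeExpr_value (hn : 1 ≤ n) (F : AdmissibleFrame S U) (p : M) :
    qPrimeExpr.value F p = 2 / (n : ℂ) ^ 2 * F.sublaplacian F.scal p
      - 4 / (n : ℂ) * F.normSqA p + 1 / (n : ℂ) ^ 2 * F.scal p ^ 2 := by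
  have n_ne_zero : (n : ℂ) ≠ 0 := by norm_cast; omega
  simp only [DimExpr.value, DimExpr.coeff, qPrimeExpr, Matrix.cons_val, Matrix.cons_val_zero,
    Matrix.cons_val_one, Polynomial.eval_ofNat, Polynomial.eval_pow, Polynomial.eval_X,
    Polynomial.eval_zero, Polynomial.eval_neg, Polynomial.eval_mul, Polynomial.eval_one,
    Complex.ofReal_div, Complex.ofReal_ofNat, Complex.ofReal_pow, Complex.ofReal_natCast,
    Complex.ofReal_zero, Complex.ofReal_neg, Complex.ofReal_mul, Complex.ofReal_one,
    zero_div, zero_mul, add_zero]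
  field_simp
  ring

theorem qPrimeExpr_representsQPrime : DimExpr.RepresentsQPrime.{u} qPrimeExpr := by
  refine ⟨fun k hk => ?_, fun k hk N _ _ _ S hS U F p hp => ?_⟩
  · have k_ne_zero : k ≠ 0 := by omega
    simpa [qPrimeExpr] using k_ne_zero
  · rw [qPrimeExpr_value (by omega), F.P4_one_of_isPseudoEinstein hk hS hp]

end Pseudohermitian

end CRGeometry

end

theorem mainTheorem11 (n : ℕ) (hn : 1 ≤ n) (M : Type*) [TopologicalSpace M]
    [ChartedSpace (CRGeometry.Model n) M] [IsManifold (𝓡 (2 * n + 1)) ∞ M]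
    (S : CRGeometry.Pseudohermitian n M) (hS : S.IsPseudoEinstein)
    (U : Set M) (F : CRGeometry.AdmissibleFrame S U) :
    F.IsQPrime (fun p => 2 / (n : ℂ) ^ 2 * F.sublaplacian F.scal p
      - 4 / (n : ℂ) * F.normSqA p + 1 / (n : ℂ) ^ 2 * F.scal p ^ 2) ∧
    (n = 1 → F.IsQPrime (fun p => 2 * F.sublaplacian F.scal p
      - 4 * F.normSqA p + F.scal p ^ 2)) := by
  have isQPrime : F.IsQPrime (fun p => 2 / (n : ℂ) ^ 2 * F.sublaplacian F.scal p
      - 4 / (n : ℂ) * F.normSqA p + 1 / (n : ℂ) ^ 2 * F.scal p ^ 2) :=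
    ⟨fun n_ne_one p hp => (F.P4_one_of_isPseudoEinstein (by omega) hS hp).symm,
      fun _ => ⟨CRGeometry.qPrimeExpr, CRGeometry.qPrimeExpr_representsQPrime,
        fun p _ => (CRGeometry.qPrimeExpr_value hn F p).symm⟩⟩
  refine ⟨isQPrime, ?_⟩
  rintro rfl
  simpa using isQPrime
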